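/- Let $G$ be a Lie group and let $F:Q\to\bar Q=Q/G$ be a smooth principal $G$-bundle. Let $g$ be a $G$-invariant Riemannian metric on $Q$, let $V\in C^\infty(Q)$ be $G$-invariant, and let $D\subseteq TQ$ be a $G$-invariant distribution (smooth vector subbundle). Let $P:TQ\to D$ be the $g$-orthogonal projector. Notation. Let $A\to M$ be a Lie algebroid with bracket $[\![\cdot,\cdot]\!]_A$, anchor $\rho_A$, bundle metric $\mathcal G$, and subbundle $C\subseteq A$, and let $P_C:A\to C$ be the orthogonal projector. Then $C$ is a skew-symmetric algebroid with $[\![X,Y]\!]_C=P_C[\![X,Y]\!]_A$ and $\rho_C=\rho_A|_C$. Its almost differential is $(d^Cf)(X)=\rho_C(X)(f)$ for $f\in C^\infty(M)$, and $$(d^C\alpha)(X,Y)=\rho_C(X)(\alpha(Y))-\rho_C(Y)(\alpha(X))-\alpha([\![X,Y]\!]_C)$$ for $\alpha\in\Gamma(C^*)$ and $X,Y\in\Gamma(C)$. A 1-cocycle is a smooth section $\alpha$ of $C^*$ with $d^C\alpha=0$. Let $\#_{\mathcal G}:A^*\to A$ and $\#_{\mathcal G_C}:C^*\to C$ be the isomorphisms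 inverse to $a\mapsto\mathcal G(a,\cdot)$ on $A$ and on $C$. Apply this to $A=TQ$, $C=D$, $\mathcal G=g$, with energy $E_L(v)=\tfrac12 g(v,v)+V(q)$ for $v\in T_qQ$. Apply it also to the Atiyah algebroid $\bar A=TQ/G\to\bar Q$ with $C=\bar D=D/G$. The sections of $\bar A$ are identified with the $G$-invariant vector fields on $Q$, the bracket is their Lie bracket, and the anchor is $[v]\mapsto TF(v)$. Here the metric $\bar{\mathcal G}$ and the function $\bar V$ are induced by $g$ and $V$, that is, $\bar{\mathcal G}([v],[w])=g(v,w)$ for $v,w\in T_qQ$ and $\bar V\circ F=V$. The energy is $E_{\bar L}(a)=\tfrac12\bar{\mathcal G}(a,a)+\bar V(b)$ for $a\in\bar A_b$. Let $\mathcal S$ be the set of 1-cocycles $\bar\alpha$ of $\bar D\to\bar Q$ satisfying the nonholonomic Hamilton–Jacobi equation $d^{\bar D}(E_{\bar L}|_{\bar D}\circ\#_{\mathcal G_{\bar D}}\circ\bar\alpha)=0$ (respectively, such that $E_{\bar L}|_{\bar D}\circ\#_{\mathcal G_{\bar D}}\circ\bar\alpha$ is constant). 1. The map $\bar\alpha\mapsto\alpha$,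 where $\alpha(q)(v)=\bar\alpha(F(q))([v])$ for $v\in D_q$, is a bijection from $\mathcal S$ onto the set of $G$-invariant 1-cocycles $\alpha$ of $D\to Q$ with $d^{D}(E_L|_D\circ\#_{g_D}\circ\alpha)=0$ (respectively, with $E_L|_D\circ\#_{g_D}\circ\alpha$ constant). 2. The map $\bar\alpha\mapsto\gamma=P^*\circ\alpha$, with $\alpha$ as in 1, so that $\gamma(q)=\alpha(q)\circ P_q$, is a bijection from $\mathcal S$ onto the set of $G$-invariant smooth 1-forms $\gamma$ on $Q$ with values in the annihilator $(D^\perp)^0\subseteq T^*Q$ such that $d\gamma$ vanishes on all pairs of vectors of $D$ (i.e. $d\gamma\in\mathcal I(D^0)$) and $d(E_L\circ\#_g\circ\gamma)(Q)\subseteq D^0$ (respectively, $d\gamma\in\mathcal I(D^0)$ and $E_L\circ\#_g\circ\gamma$ is constant). -/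

import Mathlib

open Set Function Bundle
open scoped Manifold ContDiff Topology

noncomputable section

namespace NonholonomicHJ

/-! ### Linear algebra in one fibre -/

/-- A (positive definite) scalar product on a real vector space. -/
structure ScalarProduct (W : Type*) [AddCommGroup W] [Module ℝ W] where
  form : LinearMap.BilinForm ℝ W
  symm : ∀ v w, form v w = form w v
  pos : ∀ v, v ≠ 0 → 0 < form v v

namespace ScalarProduct

variable {W W' : Type*} [AddCommGroup W] [Module ℝ W] [AddCommGroup W'] [Module ℝ W']

theorem nondegenerate (B : ScalarProduct W) : B.form.Nondegenerate := by
  constructor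
  · intro v hv
    by_contra h
    exact (B.pos v h).ne' (hv v)
  · intro v hv
    by_contra h
    exact (B.pos v h).ne' (hv v)

/-- The restriction of a scalar product to a subspace. -/
def restrict (B : ScalarProduct W) (D : Submodule ℝ W) : ScalarProduct D where
  form := B.form.restrict D
  symm v w := B.symm v w
  pos v hv := B.pos v (by simpa using hv)

/-- Transport of a scalar product along a linear isomorphism. -/
def transport (B : ScalarProduct W) (e : W ≃ₗ[ℝ] W') : ScalarProduct W' where
  form := B.form.compl₁₂ e.symm.toLinearMap e.symm.toLinearMap
  symm v w := B.symm _ _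
  pos v hv := B.pos _ (by simpa using hv)

/-- The orthogonal complement `D^⊥`. -/
def perp (B : ScalarProduct W) (D : Submodule ℝ W) : Submodule ℝ W :=
  B.form.orthogonal D

variable [FiniteDimensional ℝ W]

/-- The musical isomorphism `# : W^* → W`, inverse of `♭ : v ↦ B(v, ·)`. -/
def sharp (B : ScalarProduct W) : Module.Dual ℝ W ≃ₗ[ℝ] W :=
  (B.form.toDual B.nondegenerate).symm

/-- The orthogonal decomposition `W = D ⊕ D^⊥`. -/
theorem isCompl_perp (B : ScalarProduct W) (D : Submodule ℝ W) : IsCompl D (B.perp D) :=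
  LinearMap.BilinForm.isCompl_orthogonal_of_restrict_nondegenerate
    (fun v w h => (B.symm w v).trans h) (B.restrict D).nondegenerate

/-- The orthogonal projector `P : W → D`. -/
def proj (B : ScalarProduct W) (D : Submodule ℝ W) : W →ₗ[ℝ] D :=
  D.projectionOnto (B.perp D) (B.isCompl_perp D)

end ScalarProduct

/-! ### Brackets, anchors and almost differentials

`AlgebroidOps A` collects the operations of a skew-symmetric algebroid on a vector bundle with
fibres `A x`: which sections are smooth, the anchor, and the bracket of sections (only its values
on smooth sections matter).  Below it is only used for the standard algebroid `TQ`, the Atiyah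
algebroid `TQ/G`, and the algebroids `D`, `D/G` which these induce on the constraint bundles. -/

section Algebroid

variable {EM : Type*} [NormedAddCommGroup EM] [NormedSpace ℝ EM]
  {M : Type*} [TopologicalSpace M] [ChartedSpace EM M]
  {A : M → Type*} [∀ x, AddCommGroup (A x)] [∀ x, Module ℝ (A x)]

/-- The operations of a skew-symmetric algebroid. -/
structure AlgebroidOps (EM : Type*) [NormedAddCommGroup EM] [NormedSpace ℝ EM]
    {M : Type*} [TopologicalSpace M] [ChartedSpace EM M]
    (A : M → Type*) [∀ x, AddCommGroup (A x)] [∀ x, Module ℝ (A x)] where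
  /-- `X ∈ Γ(A)` -/
  IsSmooth : (∀ x, A x) → Prop
  /-- `ρ` -/
  anchor : ∀ x, A x →ₗ[ℝ] TangentSpace 𝓘(ℝ, EM) x
  /-- `⟦X, Y⟧` -/
  bracket : (∀ x, A x) → (∀ x, A x) → ∀ x, A x

namespace AlgebroidOps

variable (S : AlgebroidOps EM A)

/-- The almost differential of a function, `(d^A f)(v) = ρ(v)(f)`. -/
def dFun (f : M → ℝ) (x : M) : Module.Dual ℝ (A x) :=
  (mvfderiv 𝓘(ℝ, EM) f x).toLinearMap ∘ₗ S.anchor x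

/-- The almost differential of a section `α` of `A^*`,
`(d^A α)(X, Y) = ρ(X)(α(Y)) - ρ(Y)(α(X)) - α(⟦X, Y⟧)`. -/
def dForm (α : ∀ x, Module.Dual ℝ (A x)) (X Y : ∀ x, A x) (x : M) : ℝ :=
  S.dFun (fun y => α y (Y y)) x (X x) - S.dFun (fun y => α y (X y)) x (Y x)
    - α x (S.bracket X Y x)

/-- `α ∈ Γ(A^*)`: the function `α(X)` is smooth for every `X ∈ Γ(A)`. -/
def IsSmoothForm (α : ∀ x, Module.Dual ℝ (A x)) : Prop :=
  ∀ X, S.IsSmooth X → ContMDiff 𝓘(ℝ, EM) 𝓘(ℝ, ℝ) ∞ (fun x => α x (X x))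

/-- `α` is a 1-cocycle: `α ∈ Γ(A^*)` and `d^A α = 0`. -/
def IsCocycle (α : ∀ x, Module.Dual ℝ (A x)) : Prop :=
  S.IsSmoothForm α ∧ ∀ X Y, S.IsSmooth X → S.IsSmooth Y → ∀ x, S.dForm α X Y x = 0

/-- `d^A α ∈ I(D^0)`: the 2-section `d^A α` vanishes on all pairs of vectors of `D`. -/
def DFormMemIdeal (D : ∀ x, Submodule ℝ (A x)) (α : ∀ x, Module.Dual ℝ (A x)) : Prop :=
  ∀ X Y, S.IsSmooth X → S.IsSmooth Y → ∀ x, X x ∈ D x → Y x ∈ D x → S.dForm α X Y x = 0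

/-- `(d^A f)(M) ⊆ D^0`. -/
def DFunMemAnnihilator (D : ∀ x, Submodule ℝ (A x)) (f : M → ℝ) : Prop :=
  ∀ x, S.dFun f x ∈ (D x).dualAnnihilator

/-- The skew-symmetric algebroid induced on a subbundle `D` of `A` by a bundle metric:
`⟦X, Y⟧_D = P ⟦i_D ∘ X, i_D ∘ Y⟧_A` and `ρ_D = ρ_A ∘ i_D`. -/
def constrain [∀ x, FiniteDimensional ℝ (A x)] (𝒢 : ∀ x, ScalarProduct (A x))
    (D : ∀ x, Submodule ℝ (A x)) : AlgebroidOps EM (fun x => D x) where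
  IsSmooth X := S.IsSmooth (fun x => (X x : A x))
  anchor x := S.anchor x ∘ₗ (D x).subtype
  bracket X Y x := (𝒢 x).proj (D x) (S.bracket (fun y => (X y : A y)) (fun y => (Y y : A y)) x)

end AlgebroidOps

/-- The energy `E_L(a) = ½ 𝒢(a, a) + V(τ(a))` of the mechanical Lagrangian
`L(a) = ½ 𝒢(a, a) - V(τ(a))`. -/
def energy (𝒢 : ∀ x, ScalarProduct (A x)) (V : M → ℝ) (x : M) (a : A x) : ℝ :=
  (1 / 2) * (𝒢 x).form a a + V x

/-- The function `E_L ∘ #_𝒢 ∘ γ`, for a section `γ` of `A^*`. -/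
def energySharp [∀ x, FiniteDimensional ℝ (A x)] (𝒢 : ∀ x, ScalarProduct (A x)) (V : M → ℝ)
    (γ : ∀ x, Module.Dual ℝ (A x)) (x : M) : ℝ :=
  energy 𝒢 V x ((𝒢 x).sharp (γ x))

/-- The function `(E_L)|_D ∘ #_{𝒢_D} ∘ α`, for a section `α` of `D^*`. -/
def constrainedEnergySharp [∀ x, FiniteDimensional ℝ (A x)] (𝒢 : ∀ x, ScalarProduct (A x))
    (V : M → ℝ) (D : ∀ x, Submodule ℝ (A x)) (α : ∀ x, Module.Dual ℝ (D x)) (x : M) : ℝ :=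
  energy 𝒢 V x (((𝒢 x).restrict (D x)).sharp (α x) : A x)

/-- The 1-cocycles `α` of the skew-symmetric algebroid `D` which solve the nonholonomic
Hamilton-Jacobi equation `d^D((E_L)|_D ∘ #_{𝒢_D} ∘ α) = 0`. -/
def hamiltonJacobiCocycles [∀ x, FiniteDimensional ℝ (A x)] (S : AlgebroidOps EM A)
    (𝒢 : ∀ x, ScalarProduct (A x)) (V : M → ℝ) (D : ∀ x, Submodule ℝ (A x)) :
    Set (∀ x, Module.Dual ℝ (D x)) :=
  {α | (S.constrain 𝒢 D).IsCocycle α ∧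
    ∀ x, (S.constrain 𝒢 D).dFun (constrainedEnergySharp 𝒢 V D α) x = 0}

/-- The 1-cocycles `α` of the skew-symmetric algebroid `D` such that
`(E_L)|_D ∘ #_{𝒢_D} ∘ α` is constant. -/
def constantEnergyCocycles [∀ x, FiniteDimensional ℝ (A x)] (S : AlgebroidOps EM A)
    (𝒢 : ∀ x, ScalarProduct (A x)) (V : M → ℝ) (D : ∀ x, Submodule ℝ (A x)) :
    Set (∀ x, Module.Dual ℝ (D x)) :=
  {α | (S.constrain 𝒢 D).IsCocycle α ∧ ∃ c : ℝ, ∀ x, constrainedEnergySharp 𝒢 V D α x = c}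

end Algebroid

/-! ### The standard algebroid `TQ`, Riemannian metrics and distributions -/

section Tangent

variable {E : Type*} [NormedAddCommGroup E] [NormedSpace ℝ E]
  {Q : Type*} [TopologicalSpace Q] [ChartedSpace E Q]

instance [FiniteDimensional ℝ E] (q : Q) : FiniteDimensional ℝ (TangentSpace 𝓘(ℝ, E) q) :=
  inferInstanceAs (FiniteDimensional ℝ E)

instance (q : Q) : T2Space (TangentSpace 𝓘(ℝ, E) q) :=
  inferInstanceAs (T2Space E)

variable (E Q) in
/-- The standard Lie algebroid `TQ`; its differential is the exterior differential of `Q`. -/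
def tangentAlgebroid [IsManifold 𝓘(ℝ, E) ∞ Q] :
    AlgebroidOps E (fun q : Q => TangentSpace 𝓘(ℝ, E) q) where
  IsSmooth X := ContMDiff 𝓘(ℝ, E) 𝓘(ℝ, E).tangent ∞ (fun q => (⟨q, X q⟩ : TangentBundle 𝓘(ℝ, E) Q))
  anchor _ := LinearMap.id
  bracket X Y := VectorField.mlieBracket 𝓘(ℝ, E) X Y

variable (E Q) in
/-- Smooth Riemannian metrics on `Q`. -/
abbrev RiemMetric [IsManifold 𝓘(ℝ, E) ∞ Q] : Type _ :=
  ContMDiffRiemannianMetric 𝓘(ℝ, E) ∞ E (fun q : Q => TangentSpace 𝓘(ℝ, E) q)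

/-- The scalar product given by a Riemannian metric on a tangent space. -/
def RiemMetric.at [IsManifold 𝓘(ℝ, E) ∞ Q] (g : RiemMetric E Q) (q : Q) :
    ScalarProduct (TangentSpace 𝓘(ℝ, E) q) where
  form := LinearMap.mk₂ ℝ (fun v w => g.inner q v w) (by simp) (by simp) (by simp) (by simp)
  symm v w := g.symm q v w
  pos v hv := g.pos q v hv

/-- `D` is a smooth distribution (a vector subbundle of `TQ`): near each point it has a smooth
local frame. -/
def IsDistribution [IsManifold 𝓘(ℝ, E) ∞ Q]
    (D : ∀ q : Q, Submodule ℝ (TangentSpace 𝓘(ℝ, E) q)) : Prop :=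
  ∀ q₀ : Q, ∃ U : Set Q, IsOpen U ∧ q₀ ∈ U ∧
    ∃ (k : ℕ) (X : Fin k → ∀ q : Q, TangentSpace 𝓘(ℝ, E) q),
      (∀ i, ContMDiffOn 𝓘(ℝ, E) 𝓘(ℝ, E).tangent ∞
        (fun q => (⟨q, X i q⟩ : TangentBundle 𝓘(ℝ, E) Q)) U) ∧
      ∀ q ∈ U, LinearIndependent ℝ (fun i => X i q) ∧
        Submodule.span ℝ (range fun i => X i q) = D q

/-- `γ` is a smooth 1-form on `Q`, i.e. a smooth section of the cotangent bundle. -/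
def IsSmoothOneForm [IsManifold 𝓘(ℝ, E) ∞ Q]
    (γ : ∀ q : Q, TangentSpace 𝓘(ℝ, E) q →L[ℝ] ℝ) : Prop :=
  ContMDiff 𝓘(ℝ, E) (𝓘(ℝ, E).prod 𝓘(ℝ, E →L[ℝ] ℝ)) ∞
    (fun q => TotalSpace.mk' (E →L[ℝ] ℝ)
      (E := fun q : Q => TangentSpace 𝓘(ℝ, E) q →L[ℝ] ℝ) q (γ q))

/-- The 1-form `P^* ∘ α` with values in `(D^⊥)^0`, for a section `α` of `D^*`. -/
def extendByProj [FiniteDimensional ℝ E] [IsManifold 𝓘(ℝ, E) ∞ Q] (g : RiemMetric E Q)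
    (D : ∀ q : Q, Submodule ℝ (TangentSpace 𝓘(ℝ, E) q)) (α : ∀ q, Module.Dual ℝ (D q)) (q : Q) :
    TangentSpace 𝓘(ℝ, E) q →L[ℝ] ℝ :=
  LinearMap.toContinuousLinearMap (α q ∘ₗ (g.at q).proj (D q))

/-! ### Group actions and invariance -/

variable {G : Type*} [Group G] [MulAction G Q]

variable (E) in
/-- The tangent lift `T_q φ_a : T_q Q → T_{a q} Q` of the action `φ` of `G` on `Q`. -/
def tangentLift (a : G) (q : Q) :
    TangentSpace 𝓘(ℝ, E) q →L[ℝ] TangentSpace 𝓘(ℝ, E) (a • q) :=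
  mfderiv 𝓘(ℝ, E) 𝓘(ℝ, E) (fun q : Q => a • q) q

variable (G) in
/-- The Riemannian metric `g` is `G`-invariant. -/
def IsInvariantMetric [IsManifold 𝓘(ℝ, E) ∞ Q] (g : RiemMetric E Q) : Prop :=
  ∀ (a : G) (q : Q) (v w : TangentSpace 𝓘(ℝ, E) q),
    g.inner (a • q) (tangentLift E a q v) (tangentLift E a q w) = g.inner q v w

variable (G) in
/-- The distribution `D` is `G`-invariant. -/
def IsInvariantDistribution (D : ∀ q : Q, Submodule ℝ (TangentSpace 𝓘(ℝ, E) q)) : Prop :=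
  ∀ (a : G) (q : Q), ∀ v ∈ D q, tangentLift E a q v ∈ D (a • q)

/-- The section `α` of `D^*` is `G`-invariant. -/
def IsInvariantDualSection {D : ∀ q : Q, Submodule ℝ (TangentSpace 𝓘(ℝ, E) q)}
    (hD : IsInvariantDistribution G D) (α : ∀ q, Module.Dual ℝ (D q)) : Prop :=
  ∀ (a : G) (q : Q) (v : D q), α (a • q) ⟨tangentLift E a q v, hD a q v v.2⟩ = α q v

variable (G) in
/-- The 1-form `γ` on `Q` is `G`-invariant. -/
def IsInvariantOneForm (γ : ∀ q : Q, TangentSpace 𝓘(ℝ, E) q →L[ℝ] ℝ) : Prop :=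
  ∀ (a : G) (q : Q) (v : TangentSpace 𝓘(ℝ, E) q), γ (a • q) (tangentLift E a q v) = γ q v

variable (G) in
/-- The `G`-invariant smooth 1-forms `γ` on `Q` with values in `(D^⊥)^0` and `dγ ∈ I(D^0)`. -/
def invariantForms [FiniteDimensional ℝ E] [IsManifold 𝓘(ℝ, E) ∞ Q] (g : RiemMetric E Q)
    (D : ∀ q : Q, Submodule ℝ (TangentSpace 𝓘(ℝ, E) q)) :
    Set (∀ q : Q, TangentSpace 𝓘(ℝ, E) q →L[ℝ] ℝ) :=
  {γ | IsSmoothOneForm γ ∧ IsInvariantOneForm G γ ∧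
    (∀ q, ∀ v ∈ (g.at q).perp (D q), γ q v = 0) ∧
    (tangentAlgebroid E Q).DFormMemIdeal D (fun q => (γ q).toLinearMap)}

end Tangent

/-! ### Principal bundles and the Atiyah algebroid `TQ/G → Q/G` -/

section Atiyah

variable {E : Type*} [NormedAddCommGroup E] [NormedSpace ℝ E]
  {Q : Type*} [TopologicalSpace Q] [ChartedSpace E Q]
  {EB : Type*} [NormedAddCommGroup EB] [NormedSpace ℝ EB]
  {B : Type*} [TopologicalSpace B] [ChartedSpace EB B]
  {EG : Type*} [NormedAddCommGroup EG] [NormedSpace ℝ EG]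
  {G : Type*} [TopologicalSpace G] [ChartedSpace EG G] [Group G] [MulAction G Q]

/-- `F : Q → B` is a smooth principal bundle for the (left) action of the Lie group `G` on `Q`:
the action is smooth, `F` is invariant, and `F` has smooth `G`-equivariant local trivializations
`F⁻¹(U) ≅ U × G`.  (It follows that the action is free and that the fibres of `F` are the orbits,
so `B = Q/G`.) -/
structure IsPrincipalBundle (E EB EG : Type*)
    [NormedAddCommGroup E] [NormedSpace ℝ E] [NormedAddCommGroup EB] [NormedSpace ℝ EB]
    [NormedAddCommGroup EG] [NormedSpace ℝ EG]
    {Q : Type*} [TopologicalSpace Q] [ChartedSpace E Q]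
    {B : Type*} [TopologicalSpace B] [ChartedSpace EB B]
    (G : Type*) [TopologicalSpace G] [ChartedSpace EG G] [Group G] [MulAction G Q]
    (F : Q → B) : Prop where
  contMDiff_smul : ContMDiff (𝓘(ℝ, EG).prod 𝓘(ℝ, E)) 𝓘(ℝ, E) ∞ (fun p : G × Q => p.1 • p.2)
  map_smul : ∀ (a : G) (q : Q), F (a • q) = F q
  exists_trivialization : ∀ b : B, ∃ e : Trivialization G F, b ∈ e.baseSet ∧
    ContMDiffOn 𝓘(ℝ, E) (𝓘(ℝ, EB).prod 𝓘(ℝ, EG)) ∞ e e.source ∧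
    ContMDiffOn (𝓘(ℝ, EB).prod 𝓘(ℝ, EG)) 𝓘(ℝ, E) ∞ e.toOpenPartialHomeomorph.symm e.target ∧
    ∀ (a : G), ∀ q ∈ e.source, (e (a • q)).2 = a * (e q).2

namespace IsPrincipalBundle

variable {F : Q → B}

theorem contMDiff_const_smul (hF : IsPrincipalBundle E EB EG G F) (a : G) :
    ContMDiff 𝓘(ℝ, E) 𝓘(ℝ, E) ∞ (fun q : Q => a • q) :=
  hF.contMDiff_smul.comp (contMDiff_const.prodMk contMDiff_id)

theorem mdifferentiable_const_smul (hF : IsPrincipalBundle E EB EG G F) (a : G) :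
    MDifferentiable 𝓘(ℝ, E) 𝓘(ℝ, E) (fun q : Q => a • q) :=
  (hF.contMDiff_const_smul a).mdifferentiable (by simp)

theorem surjective (hF : IsPrincipalBundle E EB EG G F) : Surjective F := by
  intro b
  obtain ⟨e, hb, -⟩ := hF.exists_trivialization b
  have h : (b, (1 : G)) ∈ e.target := by rw [e.mem_target]; exact hb
  exact ⟨e.toOpenPartialHomeomorph.symm (b, 1), e.proj_symm_apply h⟩

theorem smul_eq_self (hF : IsPrincipalBundle E EB EG G F) {a : G} {q : Q} (h : a • q = q) :
    a = 1 := by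
  obtain ⟨e, hb, -, -, he⟩ := hF.exists_trivialization (F q)
  have := he a q (e.mem_source.2 hb)
  rw [h] at this
  simpa using this

theorem exists_smul_eq (hF : IsPrincipalBundle E EB EG G F) {q q' : Q} (h : F q = F q') :
    ∃ a : G, a • q = q' := by
  obtain ⟨e, hb, -, -, he⟩ := hF.exists_trivialization (F q)
  have hq : q ∈ e.source := e.mem_source.2 hb
  have hq' : q' ∈ e.source := e.mem_source.2 (h ▸ hb)
  refine ⟨(e q').2 * (e q).2⁻¹, ?_⟩
  have hs : ((e q').2 * (e q).2⁻¹) • q ∈ e.source := e.mem_source.2 (by rwa [hF.map_smul])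
  apply e.injOn hs hq'
  change e _ = e _
  apply Prod.ext
  · rw [e.coe_fst hs, e.coe_fst hq', hF.map_smul, h]
  · rw [he _ _ hq]; simp

theorem tangentMap_one (_hF : IsPrincipalBundle E EB EG G F) :
    tangentMap 𝓘(ℝ, E) 𝓘(ℝ, E) (fun q : Q => (1 : G) • q) = id := by
  have h : (fun q : Q => (1 : G) • q) = id := funext fun q => one_smul G q
  rw [h, tangentMap_id]

theorem tangentMap_mul (hF : IsPrincipalBundle E EB EG G F) (a a' : G) :
    tangentMap 𝓘(ℝ, E) 𝓘(ℝ, E) (fun q : Q => (a * a') • q) =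
      tangentMap 𝓘(ℝ, E) 𝓘(ℝ, E) (fun q : Q => a • q) ∘
        tangentMap 𝓘(ℝ, E) 𝓘(ℝ, E) (fun q : Q => a' • q) := by
  rw [← tangentMap_comp (hF.mdifferentiable_const_smul a) (hF.mdifferentiable_const_smul a')]
  congr 1
  funext q
  exact mul_smul a a' q

/-- The tangent lift of the action of an element of `G`, as a linear isomorphism. -/
theorem tangentLift_bijective (hF : IsPrincipalBundle E EB EG G F) (a : G) (q : Q) :
    Bijective (tangentLift E a q) := by
  have h₁ : ∀ a : G, Injective (tangentMap 𝓘(ℝ, E) 𝓘(ℝ, E) (fun q : Q => a • q)) := by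
    intro a
    have := hF.tangentMap_mul a⁻¹ a
    simp only [inv_mul_cancel] at this
    rw [hF.tangentMap_one] at this
    exact LeftInverse.injective (g := tangentMap 𝓘(ℝ, E) 𝓘(ℝ, E) (fun q : Q => a⁻¹ • q))
      fun x => (congrFun this x).symm
  have h₂ : Surjective (tangentMap 𝓘(ℝ, E) 𝓘(ℝ, E) (fun q : Q => a • q)) := by
    have := hF.tangentMap_mul a a⁻¹
    simp only [mul_inv_cancel] at this
    rw [hF.tangentMap_one] at this
    exact RightInverse.surjective (g := tangentMap 𝓘(ℝ, E) 𝓘(ℝ, E) (fun q : Q => a⁻¹ • q))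
      fun x => (congrFun this x).symm
  constructor
  · intro v w h
    have := @h₁ a ⟨q, v⟩ ⟨q, w⟩ (by simp only [tangentMap]; exact congrArg _ h)
    simpa using this
  · intro w
    obtain ⟨⟨q', v⟩, hv⟩ := h₂ ⟨a • q, w⟩
    have hq : q' = q := by
      have := congrArg TotalSpace.proj hv
      simpa [tangentMap] using this
    subst hq
    refine ⟨v, ?_⟩
    simpa [tangentMap, tangentLift] using hv

/-- Two vectors of `TQ` over the fibre `F⁻¹(b)` are equivalent if they lie in the same orbit of
the tangent lift of the action. -/
def orbitSetoid (hF : IsPrincipalBundle E EB EG G F) (b : B) :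
    Setoid {x : TangentBundle 𝓘(ℝ, E) Q // F x.proj = b} where
  r x y := ∃ a : G, tangentMap 𝓘(ℝ, E) 𝓘(ℝ, E) (fun q : Q => a • q) x.1 = y.1
  iseqv :=
    { refl := fun x => ⟨1, by rw [hF.tangentMap_one]; rfl⟩
      symm := by
        rintro x y ⟨a, h⟩
        refine ⟨a⁻¹, ?_⟩
        rw [← h, ← comp_apply (f := tangentMap _ _ _), ← hF.tangentMap_mul, inv_mul_cancel,
          hF.tangentMap_one]
        rfl
      trans := by
        rintro x y z ⟨a, h⟩ ⟨a', h'⟩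
        refine ⟨a' * a, ?_⟩
        rw [hF.tangentMap_mul, comp_apply, h, h'] }

/-- The fibre over `b` of `TQ/G → Q/G`: the orbits of the tangent lift of the action in the part
of `TQ` over `F⁻¹(b)`. -/
def AtiyahFibre (hF : IsPrincipalBundle E EB EG G F) (b : B) : Type _ :=
  Quotient (hF.orbitSetoid b)

/-- The class `[v] ∈ (TQ/G)_b` of a tangent vector `v ∈ T_q Q`, where `F q = b`. -/
def cls (hF : IsPrincipalBundle E EB EG G F) (q : Q) (b : B) (h : F q = b)
    (v : TangentSpace 𝓘(ℝ, E) q) : hF.AtiyahFibre b :=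
  Quotient.mk (hF.orbitSetoid b) ⟨⟨q, v⟩, h⟩

theorem cls_smul (hF : IsPrincipalBundle E EB EG G F) (a : G) (q : Q) (b : B) (h : F q = b)
    (v : TangentSpace 𝓘(ℝ, E) q) :
    hF.cls (a • q) b ((hF.map_smul a q).trans h) (tangentLift E a q v) = hF.cls q b h v :=
  (Quotient.sound (s := hF.orbitSetoid b) ⟨a, rfl⟩).symm

theorem cls_bijective (hF : IsPrincipalBundle E EB EG G F) (q : Q) (b : B) (h : F q = b) :
    Bijective (hF.cls q b h) := by
  constructor
  · intro v w hvw
    obtain ⟨a, ha⟩ := Quotient.exact (s := hF.orbitSetoid b) hvw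
    have h1 : a = 1 := hF.smul_eq_self (congrArg TotalSpace.proj ha)
    subst h1
    rw [hF.tangentMap_one] at ha
    simpa using ha
  · intro x
    induction x using Quotient.inductionOn with
    | h x =>
      obtain ⟨⟨q', v⟩, hq'⟩ := x
      obtain ⟨a, rfl⟩ := hF.exists_smul_eq (hq'.trans h.symm)
      exact ⟨tangentLift E a q' v, hF.cls_smul a q' b hq' v⟩

/-- A point of `F⁻¹(b)`.  Nothing below depends on its choice. -/
def pt (hF : IsPrincipalBundle E EB EG G F) (b : B) : Q := surjInv hF.surjective b

theorem map_pt (hF : IsPrincipalBundle E EB EG G F) (b : B) : F (hF.pt b) = b :=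
  surjInv_eq hF.surjective b

/-- The bijection `T_q Q ≃ (TQ/G)_b` for the chosen point `q` of `F⁻¹(b)`. -/
def ptEquiv (hF : IsPrincipalBundle E EB EG G F) (b : B) :
    TangentSpace 𝓘(ℝ, E) (hF.pt b) ≃ hF.AtiyahFibre b :=
  Equiv.ofBijective _ (hF.cls_bijective (hF.pt b) b (hF.map_pt b))

/-- The vector space structure of `(TQ/G)_b`: the one for which `v ↦ [v]` is linear on `T_q Q`,
for every `q ∈ F⁻¹(b)` (see `toQuot`). -/
instance (hF : IsPrincipalBundle E EB EG G F) (b : B) : AddCommGroup (hF.AtiyahFibre b) :=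
  (hF.ptEquiv b).symm.addCommGroup

instance (hF : IsPrincipalBundle E EB EG G F) (b : B) : Module ℝ (hF.AtiyahFibre b) :=
  (hF.ptEquiv b).symm.module ℝ

theorem exists_linear_cls (hF : IsPrincipalBundle E EB EG G F) (q : Q) (b : B) (h : F q = b) :
    ∃ L : TangentSpace 𝓘(ℝ, E) q →ₗ[ℝ] TangentSpace 𝓘(ℝ, E) (hF.pt b),
      ∀ v, hF.cls q b h v = hF.ptEquiv b (L v) := by
  have key : ∀ (p : Q) (hp : F p = b), ∃ L : TangentSpace 𝓘(ℝ, E) q →ₗ[ℝ] TangentSpace 𝓘(ℝ, E) p,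
      ∀ v, hF.cls q b h v = hF.cls p b hp (L v) := by
    intro p hp
    obtain ⟨a, rfl⟩ := hF.exists_smul_eq (h.trans hp.symm)
    exact ⟨(tangentLift E a q).toLinearMap, fun v => (hF.cls_smul a q b h v).symm⟩
  exact key _ (hF.map_pt b)

/-- The linear isomorphism `T_q Q ≃ (TQ/G)_b`, `v ↦ [v]`, where `F q = b`. -/
def toQuot (hF : IsPrincipalBundle E EB EG G F) (q : Q) (b : B) (h : F q = b) :
    TangentSpace 𝓘(ℝ, E) q ≃ₗ[ℝ] hF.AtiyahFibre b :=
  LinearEquiv.ofBijective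
    { toFun := hF.cls q b h
      map_add' := by
        intro v w
        obtain ⟨L, hL⟩ := hF.exists_linear_cls q b h
        rw [hL, hL, hL, map_add]
        exact ((hF.ptEquiv b).symm.linearEquiv ℝ).symm.map_add (L v) (L w)
      map_smul' := by
        intro c v
        obtain ⟨L, hL⟩ := hF.exists_linear_cls q b h
        rw [hL, hL, _root_.map_smul]
        exact ((hF.ptEquiv b).symm.linearEquiv ℝ).symm.map_smul c (L v) }
    (hF.cls_bijective q b h)

theorem toQuot_tangentLift (hF : IsPrincipalBundle E EB EG G F) (a : G) (q : Q) (b : B) (h : F q = b)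
    (v : TangentSpace 𝓘(ℝ, E) q) :
    hF.toQuot (a • q) b ((hF.map_smul a q).trans h) (tangentLift E a q v) = hF.toQuot q b h v :=
  hF.cls_smul a q b h v

instance [FiniteDimensional ℝ E] (hF : IsPrincipalBundle E EB EG G F) (b : B) :
    FiniteDimensional ℝ (hF.AtiyahFibre b) :=
  Module.Finite.equiv (hF.toQuot (hF.pt b) b (hF.map_pt b))

/-- The `G`-invariant vector field `X` on `Q` corresponding to a section `σ` of `TQ/G → Q/G`:
`[X(q)] = σ(F(q))`. -/
def lift (hF : IsPrincipalBundle E EB EG G F) (σ : ∀ b, hF.AtiyahFibre b) (q : Q) :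
    TangentSpace 𝓘(ℝ, E) q :=
  (hF.toQuot q (F q) rfl).symm (σ (F q))

/-- Smooth sections of `TQ/G → Q/G`: locally they are `b ↦ [s(b)]` for a smooth map `s` into `TQ`
(i.e. they are smooth maps into the orbit manifold `TQ/G`, the projection `TQ → TQ/G` being a
surjective submersion). -/
def IsSmoothSection [IsManifold 𝓘(ℝ, E) ∞ Q] (hF : IsPrincipalBundle E EB EG G F) (σ : ∀ b, hF.AtiyahFibre b) : Prop :=
  ∀ b₀ : B, ∃ U : Set B, IsOpen U ∧ b₀ ∈ U ∧ ∃ s : B → TangentBundle 𝓘(ℝ, E) Q,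
    ContMDiffOn 𝓘(ℝ, EB) 𝓘(ℝ, E).tangent ∞ s U ∧
    ∀ b ∈ U, ∃ h : F (s b).proj = b, σ b = hF.toQuot (s b).proj b h (s b).2

/-- The tangent map `T_q F : T_q Q → T_b B`, where `F q = b`. -/
def tangentProj (_hF : IsPrincipalBundle E EB EG G F) (q : Q) (b : B) (h : F q = b) :
    TangentSpace 𝓘(ℝ, E) q →L[ℝ] TangentSpace 𝓘(ℝ, EB) b :=
  h ▸ mfderiv 𝓘(ℝ, E) 𝓘(ℝ, EB) F q

/-- The Atiyah algebroid `TQ/G → Q/G` of the principal bundle.  Its anchor is `[v] ↦ TF(v)`, and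
the bracket of two sections is the section corresponding to the Lie bracket of the corresponding
`G`-invariant vector fields. -/
def atiyahAlgebroid [IsManifold 𝓘(ℝ, E) ∞ Q] (hF : IsPrincipalBundle E EB EG G F) :
    AlgebroidOps EB (fun b => hF.AtiyahFibre b) where
  IsSmooth := hF.IsSmoothSection
  anchor b := (hF.tangentProj (hF.pt b) b (hF.map_pt b)).toLinearMap ∘ₗ
    (hF.toQuot (hF.pt b) b (hF.map_pt b)).symm.toLinearMap
  bracket σ τ b := hF.toQuot (hF.pt b) b (hF.map_pt b)
    (VectorField.mlieBracket 𝓘(ℝ, E) (hF.lift σ) (hF.lift τ) (hF.pt b))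

/-- The bundle metric on `TQ/G` induced by a `G`-invariant Riemannian metric `g` on `Q`:
`𝒢([v], [w]) = g(v, w)`. -/
def reducedMetric [IsManifold 𝓘(ℝ, E) ∞ Q] (hF : IsPrincipalBundle E EB EG G F) (g : RiemMetric E Q)
    (b : B) : ScalarProduct (hF.AtiyahFibre b) :=
  (g.at (hF.pt b)).transport (hF.toQuot (hF.pt b) b (hF.map_pt b))

/-- The function on `Q/G` induced by a `G`-invariant function `V` on `Q`. -/
def reducedFun (hF : IsPrincipalBundle E EB EG G F) (V : Q → ℝ) (b : B) : ℝ :=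
  V (hF.pt b)

/-- The fibres of the subbundle `D/G` of `TQ/G`, for a `G`-invariant distribution `D` on `Q`. -/
def reducedDistribution (hF : IsPrincipalBundle E EB EG G F)
    (D : ∀ q : Q, Submodule ℝ (TangentSpace 𝓘(ℝ, E) q)) (b : B) :
    Submodule ℝ (hF.AtiyahFibre b) :=
  (D (hF.pt b)).map (hF.toQuot (hF.pt b) b (hF.map_pt b)).toLinearMap

/-! The choice of the points `pt b` is immaterial. -/

theorem exists_smul_pt (hF : IsPrincipalBundle E EB EG G F) (q : Q) :
    ∃ a : G, a • hF.pt (F q) = q :=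
  hF.exists_smul_eq (hF.map_pt (F q))

theorem reducedMetric_toQuot [IsManifold 𝓘(ℝ, E) ∞ Q] (hF : IsPrincipalBundle E EB EG G F)
    {g : RiemMetric E Q} (hg : IsInvariantMetric G g) (q : Q) (v w : TangentSpace 𝓘(ℝ, E) q) :
    (hF.reducedMetric g (F q)).form (hF.toQuot q (F q) rfl v) (hF.toQuot q (F q) rfl w) =
      g.inner q v w := by
  have key : ∀ (b : B) (h : F q = b), (hF.reducedMetric g b).form (hF.toQuot q b h v) (hF.toQuot q b h w) =
      g.inner q v w := by
    intro b h
    obtain ⟨a, ha⟩ := hF.exists_smul_eq (h.trans (hF.map_pt b).symm)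
    have : ∀ (p : Q) (hp : F p = b), a • q = p →
        ((g.at p).transport (hF.toQuot p b hp)).form (hF.toQuot q b h v) (hF.toQuot q b h w) =
          g.inner q v w := by
      rintro p hp rfl
      rw [← hF.toQuot_tangentLift a q b h v, ← hF.toQuot_tangentLift a q b h w, ← hg a q v w]
      simp [ScalarProduct.transport, RiemMetric.at]
    exact this _ _ ha
  exact key _ rfl

theorem reducedFun_map (hF : IsPrincipalBundle E EB EG G F) {V : Q → ℝ}
    (hV : ∀ (a : G) (q : Q), V (a • q) = V q) (q : Q) : hF.reducedFun V (F q) = V q := by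
  obtain ⟨a, ha⟩ := hF.exists_smul_pt q
  conv_rhs => rw [← ha, hV]
  rfl

theorem toQuot_mem_reducedDistribution (hF : IsPrincipalBundle E EB EG G F)
    {D : ∀ q : Q, Submodule ℝ (TangentSpace 𝓘(ℝ, E) q)} (hD : IsInvariantDistribution G D)
    (q : Q) (v : TangentSpace 𝓘(ℝ, E) q) (hv : v ∈ D q) :
    hF.toQuot q (F q) rfl v ∈ hF.reducedDistribution D (F q) := by
  have key : ∀ (b : B) (h : F q = b), hF.toQuot q b h v ∈ hF.reducedDistribution D b := by
    intro b h
    obtain ⟨a, ha⟩ := hF.exists_smul_eq (h.trans (hF.map_pt b).symm)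
    have : ∀ (p : Q) (hp : F p = b), a • q = p →
        hF.toQuot q b h v ∈ (D p).map (hF.toQuot p b hp).toLinearMap := by
      rintro p hp rfl
      exact ⟨tangentLift E a q v, hD a q v hv, hF.toQuot_tangentLift a q b h v⟩
    exact this _ _ ha
  exact key _ rfl

theorem contMDiff (hF : IsPrincipalBundle E EB EG G F) : ContMDiff 𝓘(ℝ, E) 𝓘(ℝ, EB) ∞ F := by
  intro q
  obtain ⟨e, hb, h₁, -, -⟩ := hF.exists_trivialization (F q)
  have hq : q ∈ e.source := e.mem_source.2 hb
  have h := (h₁.contMDiffAt (e.open_source.mem_nhds hq)).fst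
  refine h.congr_of_eventuallyEq ?_
  filter_upwards [e.open_source.mem_nhds hq] with x hx
  exact (e.coe_fst hx).symm

theorem tangentProj_tangentLift (hF : IsPrincipalBundle E EB EG G F) (a : G) (q : Q) (b : B)
    (h : F q = b) (v : TangentSpace 𝓘(ℝ, E) q) :
    hF.tangentProj (a • q) b ((hF.map_smul a q).trans h) (tangentLift E a q v) =
      hF.tangentProj q b h v := by
  have h₁ : tangentMap 𝓘(ℝ, E) 𝓘(ℝ, EB) F ∘
      tangentMap 𝓘(ℝ, E) 𝓘(ℝ, E) (fun q : Q => a • q) = tangentMap 𝓘(ℝ, E) 𝓘(ℝ, EB) F := by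
    rw [← tangentMap_comp (hF.contMDiff.mdifferentiable (by simp))
      (hF.mdifferentiable_const_smul a)]
    congr 1
    funext x
    exact hF.map_smul a x
  have h₂ : ∀ (q : Q) (b : B) (h : F q = b) (v : TangentSpace 𝓘(ℝ, E) q),
      (⟨b, hF.tangentProj q b h v⟩ : TangentBundle 𝓘(ℝ, EB) B) =
        tangentMap 𝓘(ℝ, E) 𝓘(ℝ, EB) F ⟨q, v⟩ := by
    rintro q b rfl v
    rfl
  have h₃ := congrFun h₁ ⟨q, v⟩
  rw [comp_apply, ← h₂ q b h v] at h₃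
  have h₄ := (h₂ (a • q) b ((hF.map_smul a q).trans h) (tangentLift E a q v)).trans h₃
  simpa using h₄

theorem anchor_toQuot [IsManifold 𝓘(ℝ, E) ∞ Q] (hF : IsPrincipalBundle E EB EG G F) (q : Q)
    (v : TangentSpace 𝓘(ℝ, E) q) :
    hF.atiyahAlgebroid.anchor (F q) (hF.toQuot q (F q) rfl v) =
      mfderiv 𝓘(ℝ, E) 𝓘(ℝ, EB) F q v := by
  obtain ⟨a, ha⟩ := hF.exists_smul_eq (hF.map_pt (F q)).symm
  have : ∀ (p : Q) (hp : F p = F q), a • q = p →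
      hF.tangentProj p (F q) hp ((hF.toQuot p (F q) hp).symm (hF.toQuot q (F q) rfl v)) =
        mfderiv 𝓘(ℝ, E) 𝓘(ℝ, EB) F q v := by
    rintro p hp rfl
    rw [← hF.toQuot_tangentLift a q (F q) rfl v, LinearEquiv.symm_apply_apply,
      hF.tangentProj_tangentLift a q (F q) rfl v]
    rfl
  exact this _ _ ha

theorem lift_smul (hF : IsPrincipalBundle E EB EG G F) (σ : ∀ b, hF.AtiyahFibre b) (a : G) (q : Q) :
    hF.lift σ (a • q) = tangentLift E a q (hF.lift σ q) := by
  apply (hF.toQuot (a • q) (F (a • q)) rfl).injective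
  have key : ∀ (b : B) (h : F (a • q) = b) (h' : F q = b),
      hF.toQuot (a • q) b h ((hF.toQuot (a • q) b h).symm (σ b)) =
        hF.toQuot (a • q) b h (tangentLift E a q ((hF.toQuot q b h').symm (σ b))) := by
    intro b h h'
    rw [hF.toQuot_tangentLift a q b h']
    simp
  have h2 : ∀ (b : B) (h : F q = b), (hF.toQuot q b h).symm (σ b) = hF.lift σ q := by
    rintro b rfl; rfl
  have := key (F (a • q)) rfl (hF.map_smul a q).symm
  rw [h2] at this
  exact this

/-- Smooth sections of `TQ/G` correspond to smooth `G`-invariant vector fields. -/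
theorem contMDiff_lift [IsManifold 𝓘(ℝ, E) ∞ Q] [LieGroup 𝓘(ℝ, EG) ∞ G]
    (hF : IsPrincipalBundle E EB EG G F)
    {σ : ∀ b, hF.AtiyahFibre b} (hσ : hF.IsSmoothSection σ) :
    ContMDiff 𝓘(ℝ, E) 𝓘(ℝ, E).tangent ∞
      (fun q => (⟨q, hF.lift σ q⟩ : TangentBundle 𝓘(ℝ, E) Q)) := by
  intro q₀
  obtain ⟨U, hU, hbU, s, hs, hσs⟩ := hσ (F q₀)
  obtain ⟨e, hb, he₁, -, he⟩ := hF.exists_trivialization (F q₀)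
  have hFc := hF.contMDiff
  have hs0 : ContMDiffAt 𝓘(ℝ, E) 𝓘(ℝ, E).tangent ∞ (fun q => s (F q)) q₀ :=
    (hs.contMDiffAt (hU.mem_nhds hbU)).comp q₀ hFc.contMDiffAt
  have hp : ContMDiffAt 𝓘(ℝ, E) 𝓘(ℝ, E) ∞ (fun q => (s (F q)).proj) q₀ :=
    ((contMDiff_proj (TangentSpace 𝓘(ℝ, E) : Q → Type _)).contMDiffAt).comp q₀ hs0
  have hps : (s (F q₀)).proj ∈ e.source := by
    obtain ⟨h, -⟩ := hσs _ hbU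
    exact e.mem_source.2 (by rwa [h])
  have hc : ContMDiffAt 𝓘(ℝ, E) 𝓘(ℝ, EG) ∞
      (fun q => (e q).2 * (e (s (F q)).proj).2⁻¹) q₀ := by
    have h₁ : ContMDiffAt 𝓘(ℝ, E) 𝓘(ℝ, EG) ∞ (fun q => (e q).2) q₀ :=
      (he₁.contMDiffAt (e.open_source.mem_nhds (e.mem_source.2 hb))).snd
    have h₂ : ContMDiffAt 𝓘(ℝ, E) 𝓘(ℝ, EG) ∞ (fun q => (e (s (F q)).proj).2) q₀ :=
      ((he₁.contMDiffAt (e.open_source.mem_nhds hps)).comp q₀ hp).snd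
    exact h₁.mul h₂.inv
  have hz : ContMDiffAt 𝓘(ℝ, E) 𝓘(ℝ, EG).tangent ∞
      (fun q => (⟨(e q).2 * (e (s (F q)).proj).2⁻¹, 0⟩ : TangentBundle 𝓘(ℝ, EG) G)) q₀ :=
    ((Bundle.contMDiff_zeroSection ℝ (TangentSpace 𝓘(ℝ, EG) : G → Type _)).contMDiffAt).comp q₀ hc
  have hm := contMDiff_equivTangentBundleProd_symm (I := 𝓘(ℝ, EG)) (M := G) (I' := 𝓘(ℝ, E))
    (M' := Q) (n := ∞)
  have ht := hF.contMDiff_smul.contMDiff_tangentMap (m := ∞) (by simp)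
  have := (ht.comp hm).contMDiffAt.comp q₀ (hz.prodMk hs0)
  refine this.congr_of_eventuallyEq ?_
  have hW : IsOpen (F ⁻¹' (U ∩ e.baseSet)) := (hU.inter e.open_baseSet).preimage hFc.continuous
  filter_upwards [hW.mem_nhds ⟨hbU, hb⟩] with q hq
  obtain ⟨h, hσq⟩ := hσs _ hq.1
  set p := (s (F q)).proj with hpdef
  set a := (e q).2 * (e p).2⁻¹ with ha
  have hpsq : p ∈ e.source := e.mem_source.2 (by rw [h]; exact hq.2)
  have hqs : q ∈ e.source := e.mem_source.2 hq.2
  have hap : a • p = q := by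
    apply e.injOn (e.mem_source.2 (by rw [hF.map_smul, h]; exact hq.2)) hqs
    change e _ = e _
    apply Prod.ext
    · rw [e.coe_fst hqs, e.coe_fst (e.mem_source.2 (by rw [hF.map_smul, h]; exact hq.2)),
        hF.map_smul, h]
    · rw [he _ _ hpsq, ha]; simp
  have hl : hF.lift σ p = (s (F q)).2 := by
    have : ∀ (b : B) (h : F p = b), (hF.toQuot p b h).symm (σ b) = hF.lift σ p := by
      rintro b rfl; rfl
    rw [← this (F q) h, hσq, LinearEquiv.symm_apply_apply]
  have h1 : (⟨q, hF.lift σ q⟩ : TangentBundle 𝓘(ℝ, E) Q) =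
      tangentMap 𝓘(ℝ, E) 𝓘(ℝ, E) (fun x : Q => a • x) (s (F q)) := by
    have : (⟨a • p, hF.lift σ (a • p)⟩ : TangentBundle 𝓘(ℝ, E) Q) =
      tangentMap 𝓘(ℝ, E) 𝓘(ℝ, E) (fun x : Q => a • x) (s (F q)) := by
      rw [hF.lift_smul, hl]; rfl
    rw [← this, hap]
  rw [h1]
  have h2 : tangentMap 𝓘(ℝ, E) 𝓘(ℝ, E) (fun x : Q => a • x) =
      tangentMap (𝓘(ℝ, EG).prod 𝓘(ℝ, E)) 𝓘(ℝ, E) (fun x : G × Q => x.1 • x.2) ∘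
        tangentMap 𝓘(ℝ, E) (𝓘(ℝ, EG).prod 𝓘(ℝ, E)) (fun x : Q => (a, x)) :=
    tangentMap_comp (f := fun x : Q => (a, x)) (hF.contMDiff_smul.mdifferentiable (by simp))
      (mdifferentiable_const.prodMk mdifferentiable_id)
  rw [h2, comp_apply, tangentMap_prod_right]
  rfl

/-- The bracket of `TQ/G` corresponds to the Lie bracket of the `G`-invariant vector fields. -/
theorem lift_bracket [FiniteDimensional ℝ E] [IsManifold 𝓘(ℝ, E) ∞ Q] [LieGroup 𝓘(ℝ, EG) ∞ G]
    (hF : IsPrincipalBundle E EB EG G F)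
    {σ τ : ∀ b, hF.AtiyahFibre b} (hσ : hF.IsSmoothSection σ) (hτ : hF.IsSmoothSection τ) :
    hF.lift (hF.atiyahAlgebroid.bracket σ τ) =
      VectorField.mlieBracket 𝓘(ℝ, E) (hF.lift σ) (hF.lift τ) := by
  have hinv : ∀ (a : G) (q : Q),
      VectorField.mlieBracket 𝓘(ℝ, E) (hF.lift σ) (hF.lift τ) (a • q) =
      tangentLift E a q (VectorField.mlieBracket 𝓘(ℝ, E) (hF.lift σ) (hF.lift τ) q) := by
    intro a q
    have : CompleteSpace E := FiniteDimensional.complete ℝ E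
    have : IsManifold 𝓘(ℝ, E) (minSmoothness ℝ 2) Q := by
      rw [minSmoothness_of_isRCLikeNormedField]; infer_instance
    have hX := hF.contMDiff_lift hσ
    have hY := hF.contMDiff_lift hτ
    let eq' : ∀ q : Q, TangentSpace 𝓘(ℝ, E) q ≃L[ℝ] TangentSpace 𝓘(ℝ, E) (a • q) := fun q =>
      (LinearEquiv.ofBijective (tangentLift E a q).toLinearMap
        (hF.tangentLift_bijective a q)).toContinuousLinearEquiv
    have hcoe : ∀ q, mfderiv 𝓘(ℝ, E) 𝓘(ℝ, E) (fun q : Q => a • q) q = (eq' q : _ →L[ℝ] _) := by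
      intro q; ext v; rfl
    have hpb : ∀ (W : ∀ q : Q, TangentSpace 𝓘(ℝ, E) q) (q : Q),
        VectorField.mpullback 𝓘(ℝ, E) 𝓘(ℝ, E) (fun q : Q => a • q) W q =
          (eq' q).symm (W (a • q)) := by
      intro W q
      rw [VectorField.mpullback, hcoe, ContinuousLinearMap.inverse_equiv]
      rfl
    have key := VectorField.mpullback_mlieBracket (I := 𝓘(ℝ, E)) (I' := 𝓘(ℝ, E)) (n := ∞)
      (f := fun q : Q => a • q) (V := hF.lift σ) (W := hF.lift τ) (x₀ := q)
      (hX.mdifferentiable (by simp) _) (hY.mdifferentiable (by simp) _)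
      (hF.contMDiff_const_smul a).contMDiffAt
      (by rw [minSmoothness_of_isRCLikeNormedField]; exact ENat.LEInfty.out)
    have hl : ∀ ρ : ∀ b, hF.AtiyahFibre b,
        VectorField.mpullback 𝓘(ℝ, E) 𝓘(ℝ, E) (fun q : Q => a • q) (hF.lift ρ) = hF.lift ρ := by
      intro ρ
      funext q
      rw [hpb, hF.lift_smul]
      exact (eq' q).symm_apply_apply _
    rw [hl, hl, hpb] at key
    rw [← key]
    exact ((eq' q).apply_symm_apply _).symm
  funext q
  obtain ⟨a, ha⟩ := hF.exists_smul_eq (hF.map_pt (F q)).symm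
  have : ∀ (p : Q) (hp : F p = F q), a • q = p →
      (hF.toQuot q (F q) rfl).symm (hF.toQuot p (F q) hp
        (VectorField.mlieBracket 𝓘(ℝ, E) (hF.lift σ) (hF.lift τ) p)) =
      VectorField.mlieBracket 𝓘(ℝ, E) (hF.lift σ) (hF.lift τ) q := by
    rintro p hp rfl
    rw [hinv, hF.toQuot_tangentLift a q (F q) rfl, LinearEquiv.symm_apply_apply]
  exact this _ _ ha

/-- The `G`-invariant section `α` of `D^*` corresponding to a section `ᾱ` of `(D/G)^*`:
`α(q)(v) = ᾱ(F(q))([v])`. -/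
def pullback (hF : IsPrincipalBundle E EB EG G F)
    {D : ∀ q : Q, Submodule ℝ (TangentSpace 𝓘(ℝ, E) q)} (hD : IsInvariantDistribution G D)
    (α : ∀ b, Module.Dual ℝ (hF.reducedDistribution D b)) (q : Q) : Module.Dual ℝ (D q) :=
  α (F q) ∘ₗ (((hF.toQuot q (F q) rfl).toLinearMap ∘ₗ (D q).subtype).codRestrict
    (hF.reducedDistribution D (F q)) fun v => hF.toQuot_mem_reducedDistribution hD q v v.2)

end IsPrincipalBundle

end Atiyah

end NonholonomicHJ

end

open NonholonomicHJ

noncomputable section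

/-! Everything is compared through the fibrewise isomorphisms `v ↦ [v]` from `T_q Q` to `(TQ/G)_b`.
Because `g` and `D` are invariant, these are isometries carrying `D_q` onto the fibre of `D/G`, so
they intertwine the orthogonal projectors and the musical isomorphisms (`proj_map`,
`sharp_restrict_map`). An invariant section of `D^*` takes the same value on all representatives of
a class, hence descends; an invariant 1-form killing `D^⊥` is `P^*` of its own restriction to `D`.
Leaving the differential conditions and smoothness aside, both maps are therefore bijections, and it
remains to match the conditions.

The core is `isCocycle_tfae`. Since `γ = P^* ∘ α` does not see the difference between a bracket and
its projection to `D`, `d^D α` is `dγ` evaluated on sections of `D` (`dForm_constrain`), and the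
almost differential on `D/G` is `dγ` evaluated on invariant fields (`dForm_constrain_atiyah`).
Passing down to `D/G` only requires inserting invariant fields. Passing up is harder, because a
cocycle on `D/G` only controls invariant fields. There are enough of them: moving a local frame of
`D` along a local section of `F`, cut off by a bump function on the base, gives global sections of
`D/G` that induce a local frame (`exists_invariant_frame`) or pass through a prescribed vector
(`exists_section_eq`). The frame and its inverse Gram matrix show that `γ` is smooth; then `dγ` is
tensorial (`dForm_congr_of_eq`), so its vanishing on invariant fields gives its vanishing on all
pairs of vectors of `D`.

For the energy, `#γ` and `#_D α` are the same vector, so the functions on `Q` coincide, and they are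
the pullback by `F` of the function on the base. The chain rule for the submersion `F` and its
surjectivity transfer the Hamilton–Jacobi equation. -/

namespace NonholonomicHJ

/-! ### Linear algebra: orthogonal projectors, musical isomorphisms and isometries. -/

namespace ScalarProduct

variable {W W' : Type*} [AddCommGroup W] [Module ℝ W] [AddCommGroup W'] [Module ℝ W']

variable [FiniteDimensional ℝ W] [FiniteDimensional ℝ W']

theorem proj_of_mem (B : ScalarProduct W) (D : Submodule ℝ W) {v : W} (hv : v ∈ D) :
    B.proj D v = ⟨v, hv⟩ :=
  Submodule.projectionOnto_apply_of_mem_left _ hv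

theorem proj_coe (B : ScalarProduct W) (D : Submodule ℝ W) (v : D) : B.proj D v = v :=
  B.proj_of_mem D v.2

theorem proj_eq_zero_iff (B : ScalarProduct W) (D : Submodule ℝ W) (v : W) :
    B.proj D v = 0 ↔ v ∈ B.perp D :=
  Submodule.projectionOnto_apply_eq_zero_iff _

theorem sub_proj_mem_perp (B : ScalarProduct W) (D : Submodule ℝ W) (v : W) :
    v - B.proj D v ∈ B.perp D := by
  rw [← B.proj_eq_zero_iff, map_sub, proj_coe, sub_self]

theorem proj_eq_of_sub_mem_perp (B : ScalarProduct W) (D : Submodule ℝ W) {v : W} {u : D}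
    (h : v - u ∈ B.perp D) : B.proj D v = u := by
  rw [← B.proj_eq_zero_iff, map_sub, proj_coe, sub_eq_zero] at h
  exact h

/-- Isometries intertwine orthogonal projectors. -/
theorem proj_map (B : ScalarProduct W) (B' : ScalarProduct W') (e : W ≃ₗ[ℝ] W')
    (he : ∀ v w, B'.form (e v) (e w) = B.form v w) (D : Submodule ℝ W) (D' : Submodule ℝ W')
    (hD : ∀ v, e v ∈ D' ↔ v ∈ D) (v : W) :
    B'.proj D' (e v) = ⟨e (B.proj D v), (hD _).2 (B.proj D v).2⟩ := by
  apply B'.proj_eq_of_sub_mem_perp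
  intro w hw
  obtain ⟨w, rfl⟩ := e.surjective w
  change B'.form (e w) (e v - e _) = 0
  rw [← map_sub, he]
  exact B.sub_proj_mem_perp D v w ((hD w).1 hw)

theorem form_sharp (B : ScalarProduct W) (φ : Module.Dual ℝ W) (v : W) :
    B.form (B.sharp φ) v = φ v :=
  LinearMap.BilinForm.apply_toDual_symm_apply (hB := B.nondegenerate) φ v

theorem sharp_eq (B : ScalarProduct W) {φ : Module.Dual ℝ W} {u : W}
    (h : ∀ v, B.form u v = φ v) : B.sharp φ = u := by
  have : B.sharp.symm u = φ := LinearMap.ext h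
  rw [← this, LinearEquiv.apply_symm_apply]

/-- Isometries intertwine the musical isomorphisms of subspaces. -/
theorem sharp_restrict_map (B : ScalarProduct W) (B' : ScalarProduct W') (e : W ≃ₗ[ℝ] W')
    (he : ∀ v w, B'.form (e v) (e w) = B.form v w) (D : Submodule ℝ W) (D' : Submodule ℝ W')
    (hD : ∀ v, e v ∈ D' ↔ v ∈ D) (α : Module.Dual ℝ D) (α' : Module.Dual ℝ D')
    (hα : ∀ v : D, α v = α' ⟨e v, (hD v).2 v.2⟩) :
    ((B'.restrict D').sharp α' : W') = e ((B.restrict D).sharp α) := by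
  have : (B'.restrict D').sharp α' =
      ⟨e ((B.restrict D).sharp α), (hD _).2 ((B.restrict D).sharp α).2⟩ := by
    apply sharp_eq
    rintro ⟨w, hw⟩
    obtain ⟨w, rfl⟩ := e.surjective w
    have h := (B.restrict D).form_sharp α ⟨w, (hD w).1 hw⟩
    rw [hα] at h
    rw [← h]
    exact he _ _
  rw [this]

/-- A vector of `D` pairs with `v` as it does with the projection of `v`. This is why `P^* ∘ α` and
`α` have the same energy. -/
theorem sharp_comp_proj (B : ScalarProduct W) (D : Submodule ℝ W) (α : Module.Dual ℝ D) :
    B.sharp (α ∘ₗ B.proj D) = ((B.restrict D).sharp α : W) := by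
  apply sharp_eq
  intro v
  have h := (B.restrict D).form_sharp α (B.proj D v)
  rw [LinearMap.comp_apply, ← h]
  have h' : B.form ((B.restrict D).sharp α) (v - B.proj D v) = 0 :=
    B.sub_proj_mem_perp D v _ ((B.restrict D).sharp α).2
  rw [map_sub, sub_eq_zero] at h'
  exact h'

end ScalarProduct

/-! ### Tensoriality of the exterior differential of a 1-form. -/

section OneForm

variable {E : Type*} [NormedAddCommGroup E] [NormedSpace ℝ E]
  {Q : Type*} [TopologicalSpace Q] [ChartedSpace E Q] [IsManifold 𝓘(ℝ, E) ∞ Q]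

theorem IsSmoothOneForm.contMDiff_apply {γ : ∀ q : Q, TangentSpace 𝓘(ℝ, E) q →L[ℝ] ℝ}
    (hγ : IsSmoothOneForm γ) {X : ∀ q : Q, TangentSpace 𝓘(ℝ, E) q}
    (hX : ContMDiff 𝓘(ℝ, E) 𝓘(ℝ, E).tangent ∞
      (fun q => (⟨q, X q⟩ : TangentBundle 𝓘(ℝ, E) Q))) :
    ContMDiff 𝓘(ℝ, E) 𝓘(ℝ, ℝ) ∞ (fun q => γ q (X q)) := by
  intro q
  have : ContMDiffAt 𝓘(ℝ, E) (𝓘(ℝ, E).prod 𝓘(ℝ, ℝ)) ∞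
      (fun m => TotalSpace.mk' ℝ (E := Bundle.Trivial Q ℝ) m (γ m (X m))) q :=
    ContMDiffAt.clm_bundle_apply (F₁ := E) (hγ q) (hX q)
  rw [contMDiffAt_totalSpace] at this
  exact this.2

theorem IsSmoothOneForm.mdifferentiableAt_apply {γ : ∀ q : Q, TangentSpace 𝓘(ℝ, E) q →L[ℝ] ℝ}
    (hγ : IsSmoothOneForm γ) {X : ∀ q : Q, TangentSpace 𝓘(ℝ, E) q} {q : Q}
    (hX : MDifferentiableAt 𝓘(ℝ, E) 𝓘(ℝ, E).tangent
      (fun q => (⟨q, X q⟩ : TangentBundle 𝓘(ℝ, E) Q)) q) :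
    MDifferentiableAt 𝓘(ℝ, E) 𝓘(ℝ, ℝ) (fun q => γ q (X q)) q := by
  have : MDifferentiableAt 𝓘(ℝ, E) (𝓘(ℝ, E).prod 𝓘(ℝ, ℝ))
      (fun m => TotalSpace.mk' ℝ (E := Bundle.Trivial Q ℝ) m (γ m (X m))) q :=
    MDifferentiableAt.clm_bundle_apply (F₁ := E) ((hγ q).mdifferentiableAt (by simp)) hX
  rw [mdifferentiableAt_totalSpace] at this
  exact this.2

/-- Reduces tensoriality in the second argument to the first. -/
theorem dForm_swap (γ : ∀ q : Q, TangentSpace 𝓘(ℝ, E) q →L[ℝ] ℝ)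
    (X Y : ∀ q : Q, TangentSpace 𝓘(ℝ, E) q) (q : Q) :
    (tangentAlgebroid E Q).dForm (fun q => (γ q).toLinearMap) X Y q =
      -(tangentAlgebroid E Q).dForm (fun q => (γ q).toLinearMap) Y X q := by
  simp only [AlgebroidOps.dForm, tangentAlgebroid]
  rw [VectorField.mlieBracket_swap_apply, map_neg]
  ring

/-- `dγ(X, Y)` is function-linear in `X`. -/
theorem tensorialAt_dForm [FiniteDimensional ℝ E]
    {γ : ∀ q : Q, TangentSpace 𝓘(ℝ, E) q →L[ℝ] ℝ}
    (hγ : IsSmoothOneForm γ) (q : Q) (Y : ∀ q : Q, TangentSpace 𝓘(ℝ, E) q) :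
    TensorialAt 𝓘(ℝ, E) E (V := fun q : Q => TangentSpace 𝓘(ℝ, E) q)
      (fun X => (tangentAlgebroid E Q).dForm (fun q => (γ q).toLinearMap) X Y q) q := by
  have : CompleteSpace E := FiniteDimensional.complete ℝ E
  have : IsManifold 𝓘(ℝ, E) (minSmoothness ℝ 2) Q := by
    rw [minSmoothness_of_isRCLikeNormedField]; infer_instance
  constructor
  · intro f X hf hX
    have hγX := hγ.mdifferentiableAt_apply hX
    -- The Leibniz term `γ(X) df(Y)` produced here cancels against the one coming from the bracket
    -- `[f X, Y]`.
    have e1 : mvfderiv 𝓘(ℝ, E) (fun y => γ y ((f • X) y)) q =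
        f q • mvfderiv 𝓘(ℝ, E) (fun y => γ y (X y)) q + γ q (X q) • mvfderiv 𝓘(ℝ, E) f q := by
      rw [← mvfderiv_mul hf hγX]
      congr 1
      funext y
      simp
    simp only [AlgebroidOps.dForm, AlgebroidOps.dFun, tangentAlgebroid,
      ContinuousLinearMap.coe_coe, LinearMap.comp_id]
    rw [e1, VectorField.mlieBracket_smul_left hf hX]
    simp
    ring
  · intro X X' hX hX'
    have e1 : mvfderiv 𝓘(ℝ, E) (fun y => γ y ((X + X') y)) q =
        mvfderiv 𝓘(ℝ, E) (fun y => γ y (X y)) q + mvfderiv 𝓘(ℝ, E) (fun y => γ y (X' y)) q := by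
      rw [← mvfderiv_add (hγ.mdifferentiableAt_apply hX) (hγ.mdifferentiableAt_apply hX')]
      congr 1
      funext y
      simp
    simp only [AlgebroidOps.dForm, AlgebroidOps.dFun, tangentAlgebroid,
      ContinuousLinearMap.coe_coe, LinearMap.comp_id]
    rw [e1, VectorField.mlieBracket_add_left hX hX']
    simp
    ring

/-- `dγ(X, Y)(q)` only depends on the values of `X` and `Y` at `q`. -/
theorem dForm_congr_of_eq [FiniteDimensional ℝ E]
    {γ : ∀ q : Q, TangentSpace 𝓘(ℝ, E) q →L[ℝ] ℝ}
    (hγ : IsSmoothOneForm γ) {q : Q} {X X' Y Y' : ∀ q : Q, TangentSpace 𝓘(ℝ, E) q}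
    (hX : (tangentAlgebroid E Q).IsSmooth X) (hX' : (tangentAlgebroid E Q).IsSmooth X')
    (hY : (tangentAlgebroid E Q).IsSmooth Y) (hY' : (tangentAlgebroid E Q).IsSmooth Y')
    (hXX' : X q = X' q) (hYY' : Y q = Y' q) :
    (tangentAlgebroid E Q).dForm (fun q => (γ q).toLinearMap) X Y q =
      (tangentAlgebroid E Q).dForm (fun q => (γ q).toLinearMap) X' Y' q := by
  have hd : ∀ {Z : ∀ q : Q, TangentSpace 𝓘(ℝ, E) q}, (tangentAlgebroid E Q).IsSmooth Z →
      MDifferentiableAt 𝓘(ℝ, E) 𝓘(ℝ, E).tangent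
        (fun q => (⟨q, Z q⟩ : TangentBundle 𝓘(ℝ, E) Q)) q :=
    fun hZ => (hZ q).mdifferentiableAt (by simp)
  have : IsManifold 𝓘(ℝ, E) (1 + 1) Q := by
    have : IsManifold 𝓘(ℝ, E) 2 Q := inferInstance
    rwa [one_add_one_eq_two]
  rw [(tensorialAt_dForm hγ q Y).pointwise (hd hX) (hd hX') hXX', dForm_swap,
    (tensorialAt_dForm hγ q X').pointwise (hd hY) (hd hY') hYY', ← dForm_swap]

end OneForm

/-! ### Descent along `F`: sections over `D/G` and invariant vector fields. -/

section

variable {E : Type*} [NormedAddCommGroup E] [NormedSpace ℝ E]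
  {Q : Type*} [TopologicalSpace Q] [ChartedSpace E Q]
  {EB : Type*} [NormedAddCommGroup EB] [NormedSpace ℝ EB]
  {B : Type*} [TopologicalSpace B] [ChartedSpace EB B]
  {EG : Type*} [NormedAddCommGroup EG] [NormedSpace ℝ EG]
  {G : Type*} [TopologicalSpace G] [ChartedSpace EG G] [Group G] [MulAction G Q]
  {F : Q → B}

namespace IsPrincipalBundle

theorem reducedDistribution_eq_map (hF : IsPrincipalBundle E EB EG G F)
    {D : ∀ q : Q, Submodule ℝ (TangentSpace 𝓘(ℝ, E) q)} (hD : IsInvariantDistribution G D)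
    (q : Q) (b : B) (h : F q = b) :
    hF.reducedDistribution D b = (D q).map (hF.toQuot q b h).toLinearMap := by
  -- Two points of one fibre differ by a group element; as the statement is symmetric in `p` and
  -- `q`, one inclusion gives both.
  have key : ∀ (p q : Q) (hp : F p = b) (hq : F q = b),
      (D p).map (hF.toQuot p b hp).toLinearMap ≤ (D q).map (hF.toQuot q b hq).toLinearMap := by
    intro p q hp hq
    obtain ⟨a, rfl⟩ := hF.exists_smul_eq (hp.trans hq.symm)
    rintro _ ⟨v, hv, rfl⟩
    exact ⟨tangentLift E a p v, hD a p v hv, hF.toQuot_tangentLift a p b hp v⟩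
  exact le_antisymm (key _ _ _ _) (key _ _ _ _)

theorem toQuot_mem_reducedDistribution_iff (hF : IsPrincipalBundle E EB EG G F)
    {D : ∀ q : Q, Submodule ℝ (TangentSpace 𝓘(ℝ, E) q)} (hD : IsInvariantDistribution G D)
    (q : Q) (b : B) (h : F q = b) (v : TangentSpace 𝓘(ℝ, E) q) :
    hF.toQuot q b h v ∈ hF.reducedDistribution D b ↔ v ∈ D q := by
  rw [hF.reducedDistribution_eq_map hD q b h]
  rw [Submodule.mem_map]
  exact ⟨fun ⟨w, hw, h⟩ => (hF.toQuot q b _).injective h ▸ hw, fun h => ⟨v, h, rfl⟩⟩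

theorem toQuot_lift (hF : IsPrincipalBundle E EB EG G F) (σ : ∀ b, hF.AtiyahFibre b)
    (q : Q) (b : B) (h : F q = b) : hF.toQuot q b h (hF.lift σ q) = σ b := by
  subst h
  exact (hF.toQuot q (F q) rfl).apply_symm_apply _

theorem lift_mem_iff (hF : IsPrincipalBundle E EB EG G F)
    {D : ∀ q : Q, Submodule ℝ (TangentSpace 𝓘(ℝ, E) q)} (hD : IsInvariantDistribution G D)
    (σ : ∀ b, hF.AtiyahFibre b) (q : Q) :
    hF.lift σ q ∈ D q ↔ σ (F q) ∈ hF.reducedDistribution D (F q) := by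
  rw [← hF.toQuot_mem_reducedDistribution_iff hD q (F q) rfl, hF.toQuot_lift]

/-- Keeping `b` separate from `F q` allows the points `q` and `a • q` to be compared inside a single
fibre, without transport along `F (a • q) = F q`. -/
theorem pullback_apply (hF : IsPrincipalBundle E EB EG G F)
    {D : ∀ q : Q, Submodule ℝ (TangentSpace 𝓘(ℝ, E) q)}
    (hD : IsInvariantDistribution G D)
    (α : ∀ b, Module.Dual ℝ (hF.reducedDistribution D b)) (q : Q) (b : B) (h : F q = b)
    (v : D q) :
    hF.pullback hD α q v =
      α b ⟨hF.toQuot q b h v, (hF.toQuot_mem_reducedDistribution_iff hD q b h v).2 v.2⟩ := by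
  subst h
  rfl

theorem isInvariantDualSection_pullback (hF : IsPrincipalBundle E EB EG G F)
    {D : ∀ q : Q, Submodule ℝ (TangentSpace 𝓘(ℝ, E) q)}
    (hD : IsInvariantDistribution G D) (α : ∀ b, Module.Dual ℝ (hF.reducedDistribution D b)) :
    IsInvariantDualSection hD (hF.pullback hD α) := by
  intro a q v
  rw [hF.pullback_apply hD α (a • q) (F q) (hF.map_smul a q), hF.pullback_apply hD α q (F q) rfl]
  congr 2
  exact hF.toQuot_tangentLift a q (F q) rfl v

theorem pullback_injective (hF : IsPrincipalBundle E EB EG G F)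
    {D : ∀ q : Q, Submodule ℝ (TangentSpace 𝓘(ℝ, E) q)}
    (hD : IsInvariantDistribution G D) : Injective (hF.pullback hD) := by
  intro α β h
  funext b
  obtain ⟨q, rfl⟩ := hF.surjective b
  ext ⟨x, hx⟩
  obtain ⟨v, rfl⟩ := (hF.toQuot q (F q) rfl).surjective x
  exact LinearMap.congr_fun (congrFun h q)
    ⟨v, (hF.toQuot_mem_reducedDistribution_iff hD q (F q) rfl v).1 hx⟩

/-- Every invariant section of `D^*` comes from a section of `(D/G)^*`. -/
theorem exists_pullback_eq (hF : IsPrincipalBundle E EB EG G F)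
    {D : ∀ q : Q, Submodule ℝ (TangentSpace 𝓘(ℝ, E) q)}
    (hD : IsInvariantDistribution G D) {α : ∀ q, Module.Dual ℝ (D q)}
    (hα : IsInvariantDualSection hD α) : ∃ β, hF.pullback hD β = α := by
  refine ⟨fun b => α (hF.pt b) ∘ₗ
    (((hF.toQuot (hF.pt b) b (hF.map_pt b)).symm.toLinearMap ∘ₗ
      (hF.reducedDistribution D b).subtype).codRestrict (D (hF.pt b)) fun x => ?_), ?_⟩
  · rw [← hF.toQuot_mem_reducedDistribution_iff hD _ b (hF.map_pt b)]
    simp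
  · funext q
    ext v
    obtain ⟨a, ha⟩ := hF.exists_smul_eq (hF.map_pt (F q)).symm
    -- The chosen point `pt (F q)` is generalized to a variable `p`, so that `p = a • q` can be
    -- substituted in the dependent types.
    have : ∀ (p : Q) (hp : F p = F q) (_ : a • q = p)
        (hv : (hF.toQuot p (F q) hp).symm (hF.toQuot q (F q) rfl v) ∈ D p),
        α p ⟨(hF.toQuot p (F q) hp).symm (hF.toQuot q (F q) rfl v), hv⟩ = α q v := by
      rintro p hp rfl hv
      rw [← hα a q v]
      congr 2
      rw [← hF.toQuot_tangentLift a q (F q) rfl v, LinearEquiv.symm_apply_apply]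
    exact this _ (hF.map_pt (F q)) ha _

/-- `ᾱ ↦ α` restricts to a bijection between sets of sections corresponding to each other. -/
theorem bijOn_pullback (hF : IsPrincipalBundle E EB EG G F)
    {D : ∀ q : Q, Submodule ℝ (TangentSpace 𝓘(ℝ, E) q)}
    (hD : IsInvariantDistribution G D)
    {S : Set (∀ b, Module.Dual ℝ (hF.reducedDistribution D b))}
    {T : Set (∀ q, Module.Dual ℝ (D q))} (h : ∀ α, α ∈ S ↔ hF.pullback hD α ∈ T) :
    BijOn (hF.pullback hD) S {α | α ∈ T ∧ IsInvariantDualSection hD α} := by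
  refine ⟨fun α hα => ⟨(h α).1 hα, hF.isInvariantDualSection_pullback hD α⟩,
    (hF.pullback_injective hD).injOn, ?_⟩
  rintro _ ⟨hT, hα⟩
  obtain ⟨β, rfl⟩ := hF.exists_pullback_eq hD hα
  exact ⟨β, (h β).2 hT, rfl⟩

/-- Local sections of `F` through a given point. -/
theorem exists_localSection (hF : IsPrincipalBundle E EB EG G F) (q₀ : Q) :
    ∃ (U : Set B) (s : B → Q), IsOpen U ∧ F q₀ ∈ U ∧ ContMDiffOn 𝓘(ℝ, EB) 𝓘(ℝ, E) ∞ s U ∧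
      (∀ b ∈ U, F (s b) = b) ∧ s (F q₀) = q₀ := by
  obtain ⟨e, hb, -, he, -⟩ := hF.exists_trivialization (F q₀)
  -- In the trivialization, the section keeps the group coordinate of `q₀`, so it passes through
  -- `q₀`.
  refine ⟨e.baseSet, fun b => e.toOpenPartialHomeomorph.symm (b, (e q₀).2), e.open_baseSet, hb,
    ?_, ?_, ?_⟩
  · refine he.comp (t := e.target) ?_ ?_
    · exact (contMDiff_id.prodMk contMDiff_const).contMDiffOn
    · intro b hb
      exact e.mem_target.2 hb
  · intro b hb
    exact e.proj_symm_apply (e.mem_target.2 hb)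
  · have hq : q₀ ∈ e.source := e.mem_source.2 hb
    have : (F q₀, (e q₀).2) = e q₀ := Prod.ext (e.coe_fst hq).symm rfl
    change e.toOpenPartialHomeomorph.symm (F q₀, (e q₀).2) = q₀
    rw [this]
    exact e.toOpenPartialHomeomorph.left_inv hq

/-- A function on the base is smooth if its pullback to the total space is. -/
theorem contMDiff_of_comp (hF : IsPrincipalBundle E EB EG G F) {f : B → ℝ}
    (hf : ContMDiff 𝓘(ℝ, E) 𝓘(ℝ, ℝ) ∞ (fun q => f (F q))) :
    ContMDiff 𝓘(ℝ, EB) 𝓘(ℝ, ℝ) ∞ f := by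
  intro b
  obtain ⟨q, rfl⟩ := hF.surjective b
  obtain ⟨U, s, hU, hbU, hs, hsF, -⟩ := hF.exists_localSection q
  have := hf.contMDiffAt.comp (F q) (hs.contMDiffAt (hU.mem_nhds hbU))
  refine this.congr_of_eventuallyEq ?_
  filter_upwards [hU.mem_nhds hbU] with b hb
  simp [hsF b hb]

/-- The chain rule for functions pulled back from the base, with no differentiability hypothesis. -/
theorem mvfderiv_comp (hF : IsPrincipalBundle E EB EG G F) (f : B → ℝ) (q : Q)
    (v : TangentSpace 𝓘(ℝ, E) q) :
    mvfderiv 𝓘(ℝ, E) (fun q => f (F q)) q v =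
      mvfderiv 𝓘(ℝ, EB) f (F q) (mfderiv 𝓘(ℝ, E) 𝓘(ℝ, EB) F q v) := by
  have hFd : MDifferentiableAt 𝓘(ℝ, E) 𝓘(ℝ, EB) F q := hF.contMDiff.mdifferentiable (by simp) q
  by_cases hf : MDifferentiableAt 𝓘(ℝ, EB) 𝓘(ℝ, ℝ) f (F q)
  · exact mvfderiv_comp_apply q hf hFd v
  -- If `f ∘ F` were differentiable at `q`, composing with a local section through `q` would make
  -- `f` differentiable. So both derivatives take their default value zero.
  · have hf' : ¬ MDifferentiableAt 𝓘(ℝ, E) 𝓘(ℝ, ℝ) (fun q => f (F q)) q := by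
      intro h
      apply hf
      obtain ⟨U, s, hU, hbU, hs, hsF, hsq⟩ := hF.exists_localSection q
      have h1 : MDifferentiableAt 𝓘(ℝ, EB) 𝓘(ℝ, ℝ) ((fun q => f (F q)) ∘ s) (F q) := by
        apply MDifferentiableAt.comp (F q) (I' := 𝓘(ℝ, E))
        · rwa [hsq]
        · exact (hs.contMDiffAt (hU.mem_nhds hbU)).mdifferentiableAt (by simp)
      refine h1.congr_of_eventuallyEq ?_
      filter_upwards [hU.mem_nhds hbU] with b hb
      simp [hsF b hb]
    simp [mvfderiv, mfderiv_zero_of_not_mdifferentiableAt hf,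
      mfderiv_zero_of_not_mdifferentiableAt hf']

/-- The almost differentials of `f` and `f ∘ F` agree. -/
theorem dFun_comp [IsManifold 𝓘(ℝ, E) ∞ Q] (hF : IsPrincipalBundle E EB EG G F) (f : B → ℝ) (q : Q)
    (v : TangentSpace 𝓘(ℝ, E) q) :
    (tangentAlgebroid E Q).dFun (fun q => f (F q)) q v =
      hF.atiyahAlgebroid.dFun f (F q) (hF.toQuot q (F q) rfl v) := by
  rw [AlgebroidOps.dFun, AlgebroidOps.dFun, LinearMap.comp_apply, LinearMap.comp_apply,
    hF.anchor_toQuot]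
  exact hF.mvfderiv_comp f q v

/-- Cutting off a vector field along a local section of `F` gives a section of `TQ/G`. -/
theorem isSmoothSection_of_localSection [IsManifold 𝓘(ℝ, E) ∞ Q]
    (hF : IsPrincipalBundle E EB EG G F)
    {W : Set B} (hW : IsOpen W) {s : B → Q} (hs : ContMDiffOn 𝓘(ℝ, EB) 𝓘(ℝ, E) ∞ s W)
    (hsF : ∀ b ∈ W, F (s b) = b) {U : Set Q} (hsU : MapsTo s W U)
    {X : ∀ q : Q, TangentSpace 𝓘(ℝ, E) q}
    (hX : ContMDiffOn 𝓘(ℝ, E) 𝓘(ℝ, E).tangent ∞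
      (fun q => (⟨q, X q⟩ : TangentBundle 𝓘(ℝ, E) Q)) U)
    {φ : B → ℝ} (hφ : ContMDiff 𝓘(ℝ, EB) 𝓘(ℝ, ℝ) ∞ φ) (hφW : tsupport φ ⊆ W)
    {σ : ∀ b, hF.AtiyahFibre b} (hσ : ∀ b (hb : b ∈ W),
      σ b = hF.toQuot (s b) b (hsF b hb) (φ b • X (s b))) (hσ0 : ∀ b ∉ tsupport φ, σ b = 0) :
    hF.IsSmoothSection σ := by
  intro b
  by_cases hb : b ∈ W
  · refine ⟨W, hW, hb, fun b => ⟨s b, φ b • X (s b)⟩, ?_, fun b hb => ⟨hsF b hb, hσ b hb⟩⟩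
    have h1 : ContMDiffOn 𝓘(ℝ, E) 𝓘(ℝ, E).tangent ∞
        (fun q => (⟨q, φ (F q) • X q⟩ : TangentBundle 𝓘(ℝ, E) Q)) U :=
      ContMDiffOn.smul_section (V := fun q : Q => TangentSpace 𝓘(ℝ, E) q)
        (hφ.comp hF.contMDiff).contMDiffOn hX
    refine (h1.comp hs hsU).congr fun b hb => ?_
    simp [hsF b hb]
  -- Off `W` the section vanishes near `b`. The zero vectors still need smoothly varying base
  -- points, and these come from another local section of `F`.
  · obtain ⟨q, rfl⟩ := hF.surjective b
    obtain ⟨U', s', hU', hbU', hs', hsF', -⟩ := hF.exists_localSection q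
    refine ⟨U' ∩ (tsupport φ)ᶜ, hU'.inter (isClosed_tsupport φ).isOpen_compl,
      ⟨hbU', fun h => hb (hφW h)⟩, fun b => ⟨s' b, 0⟩, ?_, fun b hb => ⟨hsF' b hb.1, ?_⟩⟩
    · exact (Bundle.contMDiff_zeroSection ℝ (TangentSpace 𝓘(ℝ, E) : Q → Type _)).comp_contMDiffOn
        (hs'.mono inter_subset_left)
    · rw [hσ0 b hb.2]
      exact (map_zero (hF.toQuot (s' b) b (hsF' b hb.1))).symm

/-- Local vector fields with values in an invariant distribution `D` can be changed, away from a
given point and off a local section of `F`, into those induced by global sections of `D/G`. -/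
theorem exists_sections_of_localFields [IsManifold 𝓘(ℝ, E) ∞ Q] [FiniteDimensional ℝ EB]
    [T2Space B] [IsManifold 𝓘(ℝ, EB) ∞ B] (hF : IsPrincipalBundle E EB EG G F)
    {D : ∀ q : Q, Submodule ℝ (TangentSpace 𝓘(ℝ, E) q)} (hD : IsInvariantDistribution G D)
    (q₀ : Q) {U : Set Q} (hU : IsOpen U) (hqU : q₀ ∈ U) {ι : Type*}
    {X : ι → ∀ q : Q, TangentSpace 𝓘(ℝ, E) q}
    (hX : ∀ i, ContMDiffOn 𝓘(ℝ, E) 𝓘(ℝ, E).tangent ∞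
      (fun q => (⟨q, X i q⟩ : TangentBundle 𝓘(ℝ, E) Q)) U) (hXD : ∀ i, ∀ q ∈ U, X i q ∈ D q) :
    ∃ σ : ι → ∀ b, hF.AtiyahFibre b,
      (∀ i, hF.IsSmoothSection (σ i)) ∧ (∀ i b, σ i b ∈ hF.reducedDistribution D b) ∧
      (∀ i, hF.lift (σ i) q₀ = X i q₀) ∧
      ∀ᶠ q in 𝓝 q₀, ∃ p ∈ U, ∃ e : TangentSpace 𝓘(ℝ, E) p ≃ₗ[ℝ] TangentSpace 𝓘(ℝ, E) q,
        (D p).map e.toLinearMap = D q ∧ ∀ i, hF.lift (σ i) q = e (X i p) := by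
  classical
  obtain ⟨W₀, s, hW₀, hbW₀, hs, hsF, hsq⟩ := hF.exists_localSection q₀
  obtain ⟨W, hW, hbW, hWW₀, hWU⟩ : ∃ W, IsOpen W ∧ F q₀ ∈ W ∧ W ⊆ W₀ ∧ MapsTo s W U :=
    ⟨W₀ ∩ s ⁻¹' U, hs.continuousOn.isOpen_inter_preimage hW₀ hU, ⟨hbW₀, by rwa [mem_preimage, hsq]⟩,
      inter_subset_left, fun b hb => hb.2⟩
  have hbW' : W ∈ 𝓝 (F q₀) := hW.mem_nhds hbW
  obtain ⟨φ, -, hφW⟩ :=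
    ((SmoothBumpFunction.nhds_basis_tsupport (I := 𝓘(ℝ, EB)) (F q₀)).mem_iff.1 hbW')
  -- The class of the cut-off field along `s`. Where `s` is not a section of `F` the value is a junk
  -- zero, harmless since the support of `φ` lies in `W`.
  let σ : ι → ∀ b, hF.AtiyahFibre b := fun i b =>
    if h : F (s b) = b then hF.toQuot (s b) b h (φ b • X i (s b)) else 0
  have hσ : ∀ i b (hb : F (s b) = b), σ i b = hF.toQuot (s b) b hb (φ b • X i (s b)) :=
    fun i b hb => dif_pos _
  have hσ0 : ∀ i, ∀ b ∉ tsupport φ, σ i b = 0 := by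
    intro i b hb
    have : φ b = 0 := image_eq_zero_of_notMem_tsupport hb
    by_cases h : F (s b) = b
    · simp [σ, h, this]
    · exact dif_neg h
  -- Where the cut-off is 1, the lifted field at `q` is the original field at `s (F q)`, carried
  -- over by identifying both tangent spaces with the same fibre of `TQ/G`.
  have hnear : ∀ q (hq : F q ∈ W), φ (F q) = 1 →
      ∃ e : TangentSpace 𝓘(ℝ, E) (s (F q)) ≃ₗ[ℝ] TangentSpace 𝓘(ℝ, E) q,
        (∀ v, hF.toQuot q (F q) rfl (e v) = hF.toQuot (s (F q)) (F q) (hsF _ (hWW₀ hq)) v) ∧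
        ∀ i, hF.lift (σ i) q = e (X i (s (F q))) := by
    intro q hq hφ
    refine ⟨(hF.toQuot (s (F q)) (F q) (hsF _ (hWW₀ hq))).trans (hF.toQuot q (F q) rfl).symm,
      fun v => by simp, fun i => ?_⟩
    apply (hF.toQuot q (F q) rfl).injective
    rw [hF.toQuot_lift, hσ i _ (hsF _ (hWW₀ hq)), hφ]
    simp
  refine ⟨σ, fun i => ?_, fun i b => ?_, fun i => ?_, ?_⟩
  · exact hF.isSmoothSection_of_localSection hW (hs.mono hWW₀)
      (fun b hb => hsF b (hWW₀ hb)) hWU (hX i) φ.contMDiff hφW (fun b hb => hσ i b _) (hσ0 i)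
  · by_cases hb : b ∈ W
    · rw [hσ i b (hsF b (hWW₀ hb)), hF.toQuot_mem_reducedDistribution_iff hD]
      exact Submodule.smul_mem _ _ (hXD i _ (hWU hb))
    · rw [hσ0 i b fun h => hb (hφW h)]
      exact Submodule.zero_mem _
  · apply (hF.toQuot q₀ (F q₀) rfl).injective
    rw [hF.toQuot_lift, hσ i _ (hsF _ hbW₀), φ.eq_one, one_smul]
    have : ∀ (p : Q) (hp : F p = F q₀), p = q₀ →
        hF.toQuot p (F q₀) hp (X i p) = hF.toQuot q₀ (F q₀) rfl (X i q₀) := by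
      rintro p hp rfl
      rfl
    exact this _ _ hsq
  · have h1 : ∀ᶠ b in 𝓝 (F q₀), b ∈ W ∧ φ b = 1 :=
      Filter.Eventually.and hbW' φ.eventuallyEq_one
    filter_upwards [hF.contMDiff.continuous.continuousAt.eventually h1] with q hq
    obtain ⟨e, he, hσe⟩ := hnear q hq.1 hq.2
    refine ⟨s (F q), hWU hq.1, e, ?_, hσe⟩
    have hmem : ∀ v, e v ∈ D q ↔ v ∈ D (s (F q)) := by
      intro v
      rw [← hF.toQuot_mem_reducedDistribution_iff hD q (F q) rfl, he,
        hF.toQuot_mem_reducedDistribution_iff hD]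
    ext v
    rw [Submodule.mem_map_equiv, ← hmem, e.apply_symm_apply]

/-- Near every point, an invariant distribution has a frame of invariant vector fields induced by
global sections of `D/G`. -/
theorem exists_invariant_frame [IsManifold 𝓘(ℝ, E) ∞ Q] [FiniteDimensional ℝ EB] [T2Space B]
    [IsManifold 𝓘(ℝ, EB) ∞ B]
    (hF : IsPrincipalBundle E EB EG G F)
    {D : ∀ q : Q, Submodule ℝ (TangentSpace 𝓘(ℝ, E) q)} (hDs : IsDistribution D)
    (hD : IsInvariantDistribution G D) (q₀ : Q) :
    ∃ (k : ℕ) (σ : Fin k → ∀ b, hF.AtiyahFibre b),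
      (∀ i, hF.IsSmoothSection (σ i)) ∧ (∀ i b, σ i b ∈ hF.reducedDistribution D b) ∧
      ∀ᶠ q in 𝓝 q₀, LinearIndependent ℝ (fun i => hF.lift (σ i) q) ∧
        Submodule.span ℝ (range fun i => hF.lift (σ i) q) = D q := by
  obtain ⟨U, hU, hqU, k, X, hX, hXD⟩ := hDs q₀
  have hXmem : ∀ i, ∀ q ∈ U, X i q ∈ D q := fun i q hq => by
    rw [← (hXD q hq).2]
    exact Submodule.subset_span ⟨i, rfl⟩
  obtain ⟨σ, hσs, hσD, -, hσ⟩ := hF.exists_sections_of_localFields hD q₀ hU hqU hX hXmem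
  refine ⟨k, σ, hσs, hσD, ?_⟩
  filter_upwards [hσ] with q hq
  obtain ⟨p, hp, e, he, hσe⟩ := hq
  have hXp := hXD p hp
  rw [funext hσe]
  refine ⟨hXp.1.map' e.toLinearMap e.ker, ?_⟩
  have : (range fun i => e (X i p)) = e.toLinearMap '' range fun i => X i p := by
    rw [← range_comp]; rfl
  rw [this, ← Submodule.map_span, hXp.2, he]

/-- Every vector of an invariant distribution extends to an invariant vector field in it. -/
theorem exists_section_eq [IsManifold 𝓘(ℝ, E) ∞ Q] [FiniteDimensional ℝ EB] [T2Space B]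
    [IsManifold 𝓘(ℝ, EB) ∞ B]
    (hF : IsPrincipalBundle E EB EG G F)
    {D : ∀ q : Q, Submodule ℝ (TangentSpace 𝓘(ℝ, E) q)} (hDs : IsDistribution D)
    (hD : IsInvariantDistribution G D) {q : Q} {v : TangentSpace 𝓘(ℝ, E) q} (hv : v ∈ D q) :
    ∃ σ : ∀ b, hF.AtiyahFibre b, hF.IsSmoothSection σ ∧
      (∀ b, σ b ∈ hF.reducedDistribution D b) ∧ hF.lift σ q = v := by
  obtain ⟨U, hU, hqU, k, X, hX, hXD⟩ := hDs q
  rw [← (hXD q hqU).2, Submodule.mem_span_range_iff_exists_fun] at hv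
  obtain ⟨c, hc⟩ := hv
  obtain ⟨σ, hσs, hσD, hσ, -⟩ := hF.exists_sections_of_localFields hD q hU hqU
    -- The vector is extended with constant coefficients in the local frame, then made invariant.
    (ι := Unit) (X := fun _ q => ∑ i, c i • X i q)
    (fun _ => ContMDiffOn.sum_section (V := fun q : Q => TangentSpace 𝓘(ℝ, E) q)
      fun i _ => (hX i).const_smul_section)
    (fun _ p hp => Submodule.sum_mem _ fun i _ => Submodule.smul_mem _ _ <| by
      rw [← (hXD p hp).2]
      exact Submodule.subset_span ⟨i, rfl⟩)
  exact ⟨σ (), hσs (), hσD (), (hσ ()).trans hc⟩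

end IsPrincipalBundle

end

/-! ### Smoothness of `P^* ∘ α` through Gram matrices. -/

section

variable {E : Type*} [NormedAddCommGroup E] [NormedSpace ℝ E]
  {Q : Type*} [TopologicalSpace Q] [ChartedSpace E Q]

theorem contMDiffAt_det {k : ℕ} {M : Q → Matrix (Fin k) (Fin k) ℝ} {q : Q}
    (hM : ∀ i j, ContMDiffAt 𝓘(ℝ, E) 𝓘(ℝ, ℝ) ∞ (fun p => M p i j) q) :
    ContMDiffAt 𝓘(ℝ, E) 𝓘(ℝ, ℝ) ∞ (fun p => (M p).det) q := by
  simp only [Matrix.det_apply']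
  exact contMDiffAt_finsetSum fun σ _ =>
    contMDiffAt_const.mul (contMDiffAt_finsetProd fun i _ => hM (σ i) i)

/-- Cramer's rule: the entries are quotients of determinants, the numerators being determinants of
row-updated matrices. -/
theorem contMDiffAt_inv_apply {k : ℕ} {M : Q → Matrix (Fin k) (Fin k) ℝ} {q : Q}
    (hM : ∀ i j, ContMDiffAt 𝓘(ℝ, E) 𝓘(ℝ, ℝ) ∞ (fun p => M p i j) q) (hq : (M q).det ≠ 0)
    (i j : Fin k) :
    ContMDiffAt 𝓘(ℝ, E) 𝓘(ℝ, ℝ) ∞ (fun p => (M p)⁻¹ i j) q := by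
  simp only [Matrix.inv_def, Ring.inverse_eq_inv', Matrix.smul_apply, smul_eq_mul,
    Matrix.adjugate_apply]
  refine ((contMDiffAt_det hM).inv₀ hq).mul (contMDiffAt_det fun i' j' => ?_)
  by_cases h : i' = j
  · subst h
    simp only [Matrix.updateRow_self]
    exact contMDiffAt_const
  · simp only [Matrix.updateRow_ne h]
    exact hM i' j'

variable [IsManifold 𝓘(ℝ, E) ∞ Q]

theorem contMDiffAt_inner (g : RiemMetric E Q) {X Y : ∀ q : Q, TangentSpace 𝓘(ℝ, E) q} {q : Q}
    (hX : ContMDiffAt 𝓘(ℝ, E) 𝓘(ℝ, E).tangent ∞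
      (fun q => (⟨q, X q⟩ : TangentBundle 𝓘(ℝ, E) Q)) q)
    (hY : ContMDiffAt 𝓘(ℝ, E) 𝓘(ℝ, E).tangent ∞
      (fun q => (⟨q, Y q⟩ : TangentBundle 𝓘(ℝ, E) Q)) q) :
    ContMDiffAt 𝓘(ℝ, E) 𝓘(ℝ, ℝ) ∞ (fun q => g.inner q (X q) (Y q)) q := by
  have : ContMDiffAt 𝓘(ℝ, E) (𝓘(ℝ, E).prod 𝓘(ℝ, ℝ)) ∞
      (fun m => TotalSpace.mk' ℝ (E := Bundle.Trivial Q ℝ) m (g.inner m (X m) (Y m))) q :=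
    ContMDiffAt.clm_bundle_apply₂ (F₁ := E) (F₂ := E) (g.contMDiff q) hX hY
  rw [contMDiffAt_totalSpace] at this
  exact this.2

/-- The 1-form `g(X, ·)` is smooth if `X` is. -/
theorem contMDiffAt_flat (g : RiemMetric E Q) {X : ∀ q : Q, TangentSpace 𝓘(ℝ, E) q} {q : Q}
    (hX : ContMDiffAt 𝓘(ℝ, E) 𝓘(ℝ, E).tangent ∞
      (fun q => (⟨q, X q⟩ : TangentBundle 𝓘(ℝ, E) Q)) q) :
    ContMDiffAt 𝓘(ℝ, E) (𝓘(ℝ, E).prod 𝓘(ℝ, E →L[ℝ] ℝ)) ∞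
      (fun q => TotalSpace.mk' (E →L[ℝ] ℝ)
        (E := fun q : Q => TangentSpace 𝓘(ℝ, E) q →L[ℝ] ℝ) q (g.inner q (X q))) q :=
  ContMDiffAt.clm_bundle_apply (F₁ := E) (F₂ := E →L[ℝ] ℝ)
    (E₂ := fun q : Q => TangentSpace 𝓘(ℝ, E) q →L[ℝ] ℝ) (g.contMDiff q) hX

/-- The Gram matrix of vector fields. -/
def gram (g : RiemMetric E Q) {k : ℕ} (W : Fin k → ∀ q : Q, TangentSpace 𝓘(ℝ, E) q) (q : Q) :
    Matrix (Fin k) (Fin k) ℝ :=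
  Matrix.of fun i j => g.inner q (W i q) (W j q)

/-- A kernel vector of the Gram matrix gives a combination of the fields orthogonal to each of them,
hence to itself; positivity makes it zero. -/
theorem det_gram_ne_zero (g : RiemMetric E Q) {k : ℕ}
    {W : Fin k → ∀ q : Q, TangentSpace 𝓘(ℝ, E) q} {q : Q}
    (hW : LinearIndependent ℝ fun i => W i q) : (gram g W q).det ≠ 0 := by
  intro h
  obtain ⟨c, hc, hMc⟩ := Matrix.exists_mulVec_eq_zero_iff.2 h
  have h0 : ∀ i, g.inner q (W i q) (∑ j, c j • W j q) = 0 := by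
    intro i
    have := congrFun hMc i
    simpa [gram, Matrix.mulVec, dotProduct, mul_comm] using this
  have h1 : g.inner q (∑ j, c j • W j q) (∑ j, c j • W j q) = 0 := by
    have : ∀ v, g.inner q (∑ j, c j • W j q) v = ∑ i, c i * g.inner q (W i q) v := by simp
    rw [this]
    exact Finset.sum_eq_zero fun i _ => by rw [h0, mul_zero]
  have h2 : ∑ j, c j • W j q = 0 := by
    by_contra hne
    exact (g.pos q _ hne).ne' h1
  exact hc (funext (Fintype.linearIndependent_iff.1 hW c h2))

variable [FiniteDimensional ℝ E]

theorem extendByProj_apply_of_mem (g : RiemMetric E Q)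
    {D : ∀ q : Q, Submodule ℝ (TangentSpace 𝓘(ℝ, E) q)} (α : ∀ q, Module.Dual ℝ (D q)) {q : Q}
    {v : TangentSpace 𝓘(ℝ, E) q} (hv : v ∈ D q) : extendByProj g D α q v = α q ⟨v, hv⟩ := by
  change α q ((g.at q).proj (D q) v) = _
  rw [(g.at q).proj_of_mem (D q) hv]

theorem extendByProj_apply_of_mem_perp (g : RiemMetric E Q)
    {D : ∀ q : Q, Submodule ℝ (TangentSpace 𝓘(ℝ, E) q)} (α : ∀ q, Module.Dual ℝ (D q)) {q : Q}
    {v : TangentSpace 𝓘(ℝ, E) q} (hv : v ∈ (g.at q).perp (D q)) : extendByProj g D α q v = 0 := by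
  change α q ((g.at q).proj (D q) v) = _
  rw [((g.at q).proj_eq_zero_iff (D q) v).2 hv, map_zero]

theorem eq_extendByProj (g : RiemMetric E Q)
    {D : ∀ q : Q, Submodule ℝ (TangentSpace 𝓘(ℝ, E) q)} (α : ∀ q, Module.Dual ℝ (D q)) (q : Q)
    (φ : TangentSpace 𝓘(ℝ, E) q →L[ℝ] ℝ) (h₁ : ∀ v : D q, φ v = α q v)
    (h₂ : ∀ v ∈ (g.at q).perp (D q), φ v = 0) : φ = extendByProj g D α q := by
  ext v
  have h := h₂ _ ((g.at q).sub_proj_mem_perp (D q) v)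
  rw [map_sub, sub_eq_zero] at h
  rw [h, h₁]
  rfl

/-- Writes the form through the 1-forms `g(W_j, ·)`, with coefficients built from its values on the
frame. Both sides kill `D^⊥`, so only the frame vectors have to be checked, and there the inverse
Gram matrix cancels. -/
theorem extendByProj_eq_sum (g : RiemMetric E Q)
    {D : ∀ q : Q, Submodule ℝ (TangentSpace 𝓘(ℝ, E) q)} (α : ∀ q, Module.Dual ℝ (D q)) {k : ℕ}
    {W : Fin k → ∀ q : Q, TangentSpace 𝓘(ℝ, E) q} {q : Q}
    (hW : LinearIndependent ℝ fun i => W i q)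
    (hWD : Submodule.span ℝ (range fun i => W i q) = D q) :
    extendByProj g D α q =
      ∑ i, ∑ j, ((gram g W q)⁻¹ i j * extendByProj g D α q (W i q)) • g.inner q (W j q) := by
  symm
  have hmem : ∀ i, W i q ∈ D q := fun i => by
    rw [← hWD]
    exact Submodule.subset_span ⟨i, rfl⟩
  apply eq_extendByProj
  · have key : ∀ v ∈ Submodule.span ℝ (range fun i => W i q),
        (∑ i, ∑ j, ((gram g W q)⁻¹ i j * extendByProj g D α q (W i q)) • g.inner q (W j q)) v =
          extendByProj g D α q v := by
      intro v hv
      induction hv using Submodule.span_induction with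
      | mem v hv =>
        obtain ⟨l, rfl⟩ := hv
        have hinv := Matrix.nonsing_inv_mul (gram g W q) (det_gram_ne_zero g hW).isUnit
        have h1 : ∀ i, ∑ j, (gram g W q)⁻¹ i j * g.inner q (W j q) (W l q) =
            if i = l then 1 else 0 := by
          intro i
          have := congrFun (congrFun hinv i) l
          rwa [Matrix.mul_apply, Matrix.one_apply] at this
        have h2 : ∀ i, ∑ j, (gram g W q)⁻¹ i j * extendByProj g D α q (W i q) *
            g.inner q (W j q) (W l q) =
            (if i = l then 1 else 0) * extendByProj g D α q (W i q) := by
          intro i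
          rw [← h1 i, Finset.sum_mul]
          exact Finset.sum_congr rfl fun j _ => by ring
        simp only [sum_apply, smul_apply, smul_eq_mul]
        rw [Finset.sum_congr rfl fun i _ => h2 i]
        simp
      | zero => simp only [map_zero]
      | add v w _ _ hv hw => rw [map_add, map_add, hv, hw]
      | smul c v _ hv => rw [map_smul, map_smul, hv]
    intro v
    rw [key v (by rw [hWD]; exact v.2), extendByProj_apply_of_mem g α v.2]
  · intro v hv
    simp only [sum_apply, smul_apply, smul_eq_mul]
    refine Finset.sum_eq_zero fun i _ => Finset.sum_eq_zero fun j _ => ?_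
    have : g.inner q (W j q) v = 0 := hv _ (hmem j)
    rw [this, mul_zero]

/-- `P^* ∘ α` is smooth near a point if `α` is smooth on a frame. -/
theorem contMDiffAt_extendByProj (g : RiemMetric E Q)
    {D : ∀ q : Q, Submodule ℝ (TangentSpace 𝓘(ℝ, E) q)} (α : ∀ q, Module.Dual ℝ (D q)) {k : ℕ}
    {W : Fin k → ∀ q : Q, TangentSpace 𝓘(ℝ, E) q} {q₀ : Q}
    (hWs : ∀ i, ContMDiffAt 𝓘(ℝ, E) 𝓘(ℝ, E).tangent ∞
      (fun q => (⟨q, W i q⟩ : TangentBundle 𝓘(ℝ, E) Q)) q₀)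
    (hW : ∀ᶠ q in 𝓝 q₀, LinearIndependent ℝ (fun i => W i q) ∧
      Submodule.span ℝ (range fun i => W i q) = D q)
    (hα : ∀ i, ContMDiffAt 𝓘(ℝ, E) 𝓘(ℝ, ℝ) ∞ (fun q => extendByProj g D α q (W i q)) q₀) :
    ContMDiffAt 𝓘(ℝ, E) (𝓘(ℝ, E).prod 𝓘(ℝ, E →L[ℝ] ℝ)) ∞
      (fun q => TotalSpace.mk' (E →L[ℝ] ℝ)
        (E := fun q : Q => TangentSpace 𝓘(ℝ, E) q →L[ℝ] ℝ) q (extendByProj g D α q)) q₀ := by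
  have hM : ∀ i j, ContMDiffAt 𝓘(ℝ, E) 𝓘(ℝ, ℝ) ∞ (fun p => gram g W p i j) q₀ :=
    fun i j => contMDiffAt_inner g (hWs i) (hWs j)
  have h : ContMDiffAt 𝓘(ℝ, E) (𝓘(ℝ, E).prod 𝓘(ℝ, E →L[ℝ] ℝ)) ∞
      (fun q => TotalSpace.mk' (E →L[ℝ] ℝ)
        (E := fun q : Q => TangentSpace 𝓘(ℝ, E) q →L[ℝ] ℝ) q
        (∑ i, ∑ j, ((gram g W q)⁻¹ i j * extendByProj g D α q (W i q)) • g.inner q (W j q))) q₀ :=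
    ContMDiffAt.sum_section (V := fun q : Q => TangentSpace 𝓘(ℝ, E) q →L[ℝ] ℝ) fun i _ =>
    ContMDiffAt.sum_section (V := fun q : Q => TangentSpace 𝓘(ℝ, E) q →L[ℝ] ℝ) fun j _ =>
    ContMDiffAt.smul_section (V := fun q : Q => TangentSpace 𝓘(ℝ, E) q →L[ℝ] ℝ)
      ((contMDiffAt_inv_apply hM (det_gram_ne_zero g hW.self_of_nhds.1) i j).mul (hα i))
      (contMDiffAt_flat g (hWs j))
  refine h.congr_of_eventuallyEq ?_
  filter_upwards [hW] with q hq
  exact congrArg _ (extendByProj_eq_sum g α hq.1 hq.2)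

end

/-! ### Comparison of cocycles and energies on `D/G`, on `D` and on `Q`. -/

section

variable {E : Type*} [NormedAddCommGroup E] [NormedSpace ℝ E] [FiniteDimensional ℝ E]
  {Q : Type*} [TopologicalSpace Q] [ChartedSpace E Q] [IsManifold 𝓘(ℝ, E) ∞ Q]

/-- The almost differential of a section of `D^*` is the restriction of `d(P^* ∘ α)`. -/
theorem dForm_constrain (g : RiemMetric E Q) (D : ∀ q : Q, Submodule ℝ (TangentSpace 𝓘(ℝ, E) q))
    (α : ∀ q, Module.Dual ℝ (D q)) (X Y : ∀ q, D q) (q : Q) :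
    ((tangentAlgebroid E Q).constrain g.at D).dForm α X Y q =
      (tangentAlgebroid E Q).dForm (fun q => (extendByProj g D α q).toLinearMap)
        (fun q => X q) (fun q => Y q) q := by
  have h : ∀ Z : ∀ q, D q, (fun q => (extendByProj g D α q).toLinearMap (Z q)) =
      fun q => α q (Z q) :=
    fun Z => funext fun q => extendByProj_apply_of_mem g α (Z q).2
  simp only [AlgebroidOps.dForm, h]
  rfl

theorem energySharp_extendByProj (g : RiemMetric E Q) (V : Q → ℝ)
    (D : ∀ q : Q, Submodule ℝ (TangentSpace 𝓘(ℝ, E) q)) (α : ∀ q, Module.Dual ℝ (D q)) :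
    energySharp g.at V (fun q => (extendByProj g D α q).toLinearMap) =
      constrainedEnergySharp g.at V D α := by
  funext q
  have : (extendByProj g D α q).toLinearMap = α q ∘ₗ (g.at q).proj (D q) := rfl
  rw [energySharp, constrainedEnergySharp, this, ScalarProduct.sharp_comp_proj]

theorem dFun_constrain_eq_zero_iff (g : RiemMetric E Q)
    (D : ∀ q : Q, Submodule ℝ (TangentSpace 𝓘(ℝ, E) q)) (f : Q → ℝ) (q : Q) :
    ((tangentAlgebroid E Q).constrain g.at D).dFun f q = 0 ↔
      ∀ v ∈ D q, (tangentAlgebroid E Q).dFun f q v = 0 :=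
  ⟨fun h v hv => LinearMap.congr_fun h ⟨v, hv⟩, fun h => LinearMap.ext fun v => h v v.2⟩

theorem extendByProj_injective (g : RiemMetric E Q)
    (D : ∀ q : Q, Submodule ℝ (TangentSpace 𝓘(ℝ, E) q)) : Injective (extendByProj g D) := by
  intro α β h
  funext q
  ext v
  have := congrFun h q
  rw [← extendByProj_apply_of_mem g α v.2, this, extendByProj_apply_of_mem g β v.2]

variable {EB : Type*} [NormedAddCommGroup EB] [NormedSpace ℝ EB]
  {B : Type*} [TopologicalSpace B] [ChartedSpace EB B]
  {EG : Type*} [NormedAddCommGroup EG] [NormedSpace ℝ EG]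
  {G : Type*} [TopologicalSpace G] [ChartedSpace EG G] [Group G] [MulAction G Q]
  {F : Q → B} {g : RiemMetric E Q} {D : ∀ q : Q, Submodule ℝ (TangentSpace 𝓘(ℝ, E) q)}

namespace IsPrincipalBundle

/-- Holds because `v ↦ [v]` is an isometry matching `D` with `D/G`. The right side involves `v` only
through its class, which yields invariance of the 1-form. -/
theorem extendByProj_pullback_apply (hF : IsPrincipalBundle E EB EG G F)
    (hg : IsInvariantMetric G g) (hD : IsInvariantDistribution G D)
    (α : ∀ b, Module.Dual ℝ (hF.reducedDistribution D b)) (q : Q) (b : B) (h : F q = b)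
    (v : TangentSpace 𝓘(ℝ, E) q) :
    extendByProj g D (hF.pullback hD α) q v =
      α b ((hF.reducedMetric g b).proj (hF.reducedDistribution D b) (hF.toQuot q b h v)) := by
  subst h
  rw [(g.at q).proj_map (hF.reducedMetric g (F q)) (hF.toQuot q (F q) rfl)
    (hF.reducedMetric_toQuot hg q) (D q) (hF.reducedDistribution D (F q))
    (hF.toQuot_mem_reducedDistribution_iff hD q (F q) rfl)]
  rfl

theorem isInvariantOneForm_extendByProj_pullback (hF : IsPrincipalBundle E EB EG G F)
    (hg : IsInvariantMetric G g) (hD : IsInvariantDistribution G D)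
    (α : ∀ b, Module.Dual ℝ (hF.reducedDistribution D b)) :
    IsInvariantOneForm G (extendByProj g D (hF.pullback hD α)) := by
  intro a q v
  rw [hF.extendByProj_pullback_apply hg hD α (a • q) (F q) (hF.map_smul a q),
    hF.extendByProj_pullback_apply hg hD α q (F q) rfl, hF.toQuot_tangentLift a q (F q) rfl v]

theorem exists_extendByProj_pullback_eq (hF : IsPrincipalBundle E EB EG G F)
    (hD : IsInvariantDistribution G D)
    {γ : ∀ q : Q, TangentSpace 𝓘(ℝ, E) q →L[ℝ] ℝ} (hγ : IsInvariantOneForm G γ)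
    (hγD : ∀ q, ∀ v ∈ (g.at q).perp (D q), γ q v = 0) :
    ∃ α, extendByProj g D (hF.pullback hD α) = γ := by
  obtain ⟨α, hα⟩ := hF.exists_pullback_eq hD
    (α := fun q => (γ q).toLinearMap ∘ₗ (D q).subtype) fun a q v => hγ a q v
  refine ⟨α, ?_⟩
  rw [hα]
  funext q
  exact (eq_extendByProj g _ q (γ q) (fun _ => rfl) (hγD q)).symm

/-- The energies on `D` and on `D/G` correspond to each other. -/
theorem constrainedEnergySharp_pullback (hF : IsPrincipalBundle E EB EG G F)
    (hg : IsInvariantMetric G g) {V : Q → ℝ} (hV : ∀ (a : G) (q : Q), V (a • q) = V q)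
    (hD : IsInvariantDistribution G D)
    (α : ∀ b, Module.Dual ℝ (hF.reducedDistribution D b)) :
    constrainedEnergySharp g.at V D (hF.pullback hD α) = fun q =>
      constrainedEnergySharp (hF.reducedMetric g) (hF.reducedFun V) (hF.reducedDistribution D) α
        (F q) := by
  funext q
  rw [constrainedEnergySharp, constrainedEnergySharp,
    (g.at q).sharp_restrict_map (hF.reducedMetric g (F q)) (hF.toQuot q (F q) rfl)
    (hF.reducedMetric_toQuot hg q) (D q) (hF.reducedDistribution D (F q))
    (hF.toQuot_mem_reducedDistribution_iff hD q (F q) rfl) (hF.pullback hD α q) (α (F q))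
    fun v => rfl, energy, energy, hF.reducedMetric_toQuot hg, hF.reducedFun_map hV]
  rfl

/-- Vectors of `D/G` are exactly the classes of vectors of `D`, and the anchor turns the reduced
differential into the chain rule. No regularity of `f` is needed, so it applies directly to the
energy function. -/
theorem dFun_constrain_comp_eq_zero_iff (hF : IsPrincipalBundle E EB EG G F)
    (hD : IsInvariantDistribution G D) (f : B → ℝ) (q : Q) :
    (hF.atiyahAlgebroid.constrain (hF.reducedMetric g) (hF.reducedDistribution D)).dFun f (F q) = 0 ↔
      ((tangentAlgebroid E Q).constrain g.at D).dFun (fun q => f (F q)) q = 0 := by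
  rw [dFun_constrain_eq_zero_iff]
  constructor
  · intro h v hv
    rw [hF.dFun_comp]
    exact LinearMap.congr_fun h ⟨_, (hF.toQuot_mem_reducedDistribution_iff hD q (F q) rfl v).2 hv⟩
  · intro h
    ext ⟨x, hx⟩
    obtain ⟨v, rfl⟩ := (hF.toQuot q (F q) rfl).surjective x
    have := h v ((hF.toQuot_mem_reducedDistribution_iff hD q (F q) rfl v).1 hx)
    rw [hF.dFun_comp] at this
    exact this

theorem extendByProj_pullback_lift (hF : IsPrincipalBundle E EB EG G F)
    (hg : IsInvariantMetric G g) (hD : IsInvariantDistribution G D)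
    (α : ∀ b, Module.Dual ℝ (hF.reducedDistribution D b))
    (σ : ∀ b, hF.reducedDistribution D b) (q : Q) :
    extendByProj g D (hF.pullback hD α) q (hF.lift (fun b => σ b) q) = α (F q) (σ (F q)) := by
  rw [hF.extendByProj_pullback_apply hg hD α q (F q) rfl, hF.toQuot_lift, ScalarProduct.proj_coe]

/-- The almost differential on `D/G`, in terms of invariant vector fields. -/
theorem dForm_constrain_atiyah [LieGroup 𝓘(ℝ, EG) ∞ G] (hF : IsPrincipalBundle E EB EG G F)
    (hg : IsInvariantMetric G g) (hD : IsInvariantDistribution G D)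
    (α : ∀ b, Module.Dual ℝ (hF.reducedDistribution D b))
    {σ τ : ∀ b, hF.reducedDistribution D b} (hσ : hF.IsSmoothSection fun b => σ b)
    (hτ : hF.IsSmoothSection fun b => τ b) (q : Q) :
    (hF.atiyahAlgebroid.constrain (hF.reducedMetric g) (hF.reducedDistribution D)).dForm α σ τ
        (F q) =
      (tangentAlgebroid E Q).dForm
        (fun q => (extendByProj g D (hF.pullback hD α) q).toLinearMap)
        (hF.lift fun b => σ b) (hF.lift fun b => τ b) q := by
  have hl : ∀ ρ : ∀ b, hF.reducedDistribution D b,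
      (fun q => (extendByProj g D (hF.pullback hD α) q).toLinearMap (hF.lift (fun b => ρ b) q)) =
        fun q => α (F q) (ρ (F q)) :=
    fun ρ => funext fun q => hF.extendByProj_pullback_lift hg hD α ρ q
  have hd : ∀ (ρ : ∀ b, hF.reducedDistribution D b) (f : B → ℝ),
      (hF.atiyahAlgebroid.constrain (hF.reducedMetric g) (hF.reducedDistribution D)).dFun f (F q)
        (ρ (F q)) = (tangentAlgebroid E Q).dFun (fun q => f (F q)) q
          (hF.lift (fun b => ρ b) q) := by
    intro ρ f
    rw [hF.dFun_comp, hF.toQuot_lift]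
    rfl
  have hb : α (F q) ((hF.atiyahAlgebroid.constrain (hF.reducedMetric g)
      (hF.reducedDistribution D)).bracket σ τ (F q)) =
      (extendByProj g D (hF.pullback hD α) q).toLinearMap
        ((tangentAlgebroid E Q).bracket (hF.lift fun b => σ b) (hF.lift fun b => τ b) q) := by
    -- The bracket of the lifts is the lift of the unprojected Atiyah bracket; the projector in the
    -- constrained bracket is the one hidden in `extendByProj`.
    have h := congrFun (hF.lift_bracket hσ hτ) q
    have h' : (tangentAlgebroid E Q).bracket (hF.lift fun b => σ b) (hF.lift fun b => τ b) q =
        hF.lift (hF.atiyahAlgebroid.bracket (fun b => σ b) fun b => τ b) q := h.symm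
    rw [h', ContinuousLinearMap.coe_coe, hF.extendByProj_pullback_apply hg hD α q (F q) rfl,
      hF.toQuot_lift]
    rfl
  rw [AlgebroidOps.dForm, AlgebroidOps.dForm, hl, hl, hb, hd σ fun b => α b (τ b),
    hd τ fun b => α b (σ b)]

/-- The three descriptions of cocycles: on `D/G`, on `D`, and as 1-forms on `Q`. -/
theorem isCocycle_tfae [LieGroup 𝓘(ℝ, EG) ∞ G] [FiniteDimensional ℝ EB] [T2Space B]
    [IsManifold 𝓘(ℝ, EB) ∞ B] (hF : IsPrincipalBundle E EB EG G F)
    (hg : IsInvariantMetric G g) (hDs : IsDistribution D) (hD : IsInvariantDistribution G D)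
    (α : ∀ b, Module.Dual ℝ (hF.reducedDistribution D b)) :
    List.TFAE [
      (hF.atiyahAlgebroid.constrain (hF.reducedMetric g) (hF.reducedDistribution D)).IsCocycle α,
      IsSmoothOneForm (extendByProj g D (hF.pullback hD α)) ∧
        (tangentAlgebroid E Q).DFormMemIdeal D
          (fun q => (extendByProj g D (hF.pullback hD α) q).toLinearMap),
      ((tangentAlgebroid E Q).constrain g.at D).IsCocycle (hF.pullback hD α)] := by
  tfae_have 1 → 2 := by
    rintro ⟨hs, hc⟩
    -- Smoothness must come first: the tensoriality used below differentiates `γ`.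
    have hsm : IsSmoothOneForm (extendByProj g D (hF.pullback hD α)) := by
      intro q
      obtain ⟨k, σ, hσ, hσD, hframe⟩ := hF.exists_invariant_frame hDs hD q
      refine contMDiffAt_extendByProj g _ (fun i => hF.contMDiff_lift (hσ i) q) hframe fun i => ?_
      have := ((hs (fun b => ⟨σ i b, hσD i b⟩) (hσ i)).comp hF.contMDiff).contMDiffAt (x := q)
      refine this.congr_of_eventuallyEq (Filter.Eventually.of_forall fun q => ?_)
      exact hF.extendByProj_pullback_lift hg hD α (fun b => ⟨σ i b, hσD i b⟩) q
    refine ⟨hsm, fun X Y hX hY q hXq hYq => ?_⟩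
    -- `X` and `Y` lie in `D` only at `q` and need not be invariant; invariant fields in `D` with
    -- the same values at `q` replace them.
    obtain ⟨σ, hσ, hσD, hσq⟩ := hF.exists_section_eq hDs hD hXq
    obtain ⟨τ, hτ, hτD, hτq⟩ := hF.exists_section_eq hDs hD hYq
    rw [dForm_congr_of_eq hsm hX (hF.contMDiff_lift hσ) hY (hF.contMDiff_lift hτ) hσq.symm
      hτq.symm, ← hF.dForm_constrain_atiyah hg hD α (σ := fun b => ⟨σ b, hσD b⟩)
      (τ := fun b => ⟨τ b, hτD b⟩) hσ hτ]
    exact hc (fun b => ⟨σ b, hσD b⟩) (fun b => ⟨τ b, hτD b⟩) hσ hτ _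
  tfae_have 2 → 3 := by
    rintro ⟨hs, hc⟩
    refine ⟨fun X hX => ?_, fun X Y hX hY q => ?_⟩
    · refine (hs.contMDiff_apply hX).congr fun q => ?_
      exact (extendByProj_apply_of_mem g _ (X q).2).symm
    · rw [dForm_constrain]
      exact hc _ _ hX hY q (X q).2 (Y q).2
  tfae_have 3 → 1 := by
    rintro ⟨hs, hc⟩
    have hmem : ∀ (σ : ∀ b, hF.reducedDistribution D b) (q : Q),
        hF.lift (fun b => σ b) q ∈ D q :=
      fun σ q => (hF.lift_mem_iff hD _ q).2 (σ (F q)).2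
    refine ⟨fun σ hσ => ?_, fun σ τ hσ hτ b => ?_⟩
    -- The pullback of `α(σ)` to `Q` is the pulled-back cocycle evaluated on the lift of `σ`, a
    -- smooth section of `D`.
    · apply hF.contMDiff_of_comp
      refine (hs (fun q => ⟨hF.lift (fun b => σ b) q, hmem σ q⟩) (hF.contMDiff_lift hσ)).congr
        fun q => ?_
      rw [← hF.extendByProj_pullback_lift hg hD α σ q, extendByProj_apply_of_mem g _ (hmem σ q)]
    · obtain ⟨q, rfl⟩ := hF.surjective b
      rw [hF.dForm_constrain_atiyah hg hD α hσ hτ]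
      have := hc (fun q => ⟨hF.lift (fun b => σ b) q, hmem σ q⟩)
        (fun q => ⟨hF.lift (fun b => τ b) q, hmem τ q⟩) (hF.contMDiff_lift hσ)
        (hF.contMDiff_lift hτ) q
      rwa [dForm_constrain] at this
  tfae_finish

/-- `ᾱ ↦ P^* ∘ α` restricts to a bijection between sets corresponding to each other. -/
theorem bijOn_extendByProj_pullback (hF : IsPrincipalBundle E EB EG G F)
    (hg : IsInvariantMetric G g) (hD : IsInvariantDistribution G D)
    {S : Set (∀ b, Module.Dual ℝ (hF.reducedDistribution D b))}
    {p : (∀ q : Q, TangentSpace 𝓘(ℝ, E) q →L[ℝ] ℝ) → Prop}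
    (h : ∀ α, α ∈ S ↔ (IsSmoothOneForm (extendByProj g D (hF.pullback hD α)) ∧
        (tangentAlgebroid E Q).DFormMemIdeal D
          (fun q => (extendByProj g D (hF.pullback hD α) q).toLinearMap)) ∧
      p (extendByProj g D (hF.pullback hD α))) :
    BijOn (fun α => extendByProj g D (hF.pullback hD α)) S
      {γ | γ ∈ invariantForms G g D ∧ p γ} := by
  refine ⟨fun α hα => ?_,
    ((extendByProj_injective g D).comp (hF.pullback_injective hD)).injOn, ?_⟩
  · obtain ⟨⟨hs, hc⟩, hp⟩ := (h α).1 hα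
    exact ⟨⟨hs, hF.isInvariantOneForm_extendByProj_pullback hg hD α,
      fun q v hv => extendByProj_apply_of_mem_perp g _ hv, hc⟩, hp⟩
  · rintro _ ⟨⟨hs, hi, hperp, hc⟩, hp⟩
    obtain ⟨α, rfl⟩ := hF.exists_extendByProj_pullback_eq hD hi hperp
    exact ⟨α, (h α).2 ⟨⟨hs, hc⟩, hp⟩, rfl⟩

end IsPrincipalBundle

end

end NonholonomicHJ

end

/-! ### The main theorem. -/

theorem mainTheorem12
    {E : Type*} [NormedAddCommGroup E] [NormedSpace ℝ E] [FiniteDimensional ℝ E]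
    {Q : Type*} [TopologicalSpace Q] [T2Space Q] [SigmaCompactSpace Q]
    [ChartedSpace E Q] [IsManifold 𝓘(ℝ, E) ∞ Q]
    {EB : Type*} [NormedAddCommGroup EB] [NormedSpace ℝ EB] [FiniteDimensional ℝ EB]
    {B : Type*} [TopologicalSpace B] [T2Space B] [SigmaCompactSpace B]
    [ChartedSpace EB B] [IsManifold 𝓘(ℝ, EB) ∞ B]
    {EG : Type*} [NormedAddCommGroup EG] [NormedSpace ℝ EG] [FiniteDimensional ℝ EG]
    {G : Type*} [TopologicalSpace G] [ChartedSpace EG G] [Group G] [LieGroup 𝓘(ℝ, EG) ∞ G]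
    [MulAction G Q]
    (F : Q → B) (hF : IsPrincipalBundle E EB EG G F)
    (g : RiemMetric E Q) (hg : IsInvariantMetric G g)
    (V : Q → ℝ) (hVs : ContMDiff 𝓘(ℝ, E) 𝓘(ℝ, ℝ) ∞ V) (hV : ∀ (a : G) (q : Q), V (a • q) = V q)
    (D : ∀ q : Q, Submodule ℝ (TangentSpace 𝓘(ℝ, E) q)) (hDs : IsDistribution D)
    (hD : IsInvariantDistribution G D) :
    -- solutions of the nonholonomic Hamilton-Jacobi equation
    (BijOn (hF.pullback hD)
        (hamiltonJacobiCocycles hF.atiyahAlgebroid (hF.reducedMetric g) (hF.reducedFun V)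
          (hF.reducedDistribution D))
        {α | α ∈ hamiltonJacobiCocycles (tangentAlgebroid E Q) g.at V D ∧
          IsInvariantDualSection hD α} ∧
      BijOn (fun α => extendByProj g D (hF.pullback hD α))
        (hamiltonJacobiCocycles hF.atiyahAlgebroid (hF.reducedMetric g) (hF.reducedFun V)
          (hF.reducedDistribution D))
        {γ | γ ∈ invariantForms G g D ∧ (tangentAlgebroid E Q).DFunMemAnnihilator D
          (energySharp g.at V (fun q => (γ q).toLinearMap))}) ∧
    -- constant energy
    (BijOn (hF.pullback hD)
        (constantEnergyCocycles hF.atiyahAlgebroid (hF.reducedMetric g) (hF.reducedFun V)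
          (hF.reducedDistribution D))
        {α | α ∈ constantEnergyCocycles (tangentAlgebroid E Q) g.at V D ∧
          IsInvariantDualSection hD α} ∧
      BijOn (fun α => extendByProj g D (hF.pullback hD α))
        (constantEnergyCocycles hF.atiyahAlgebroid (hF.reducedMetric g) (hF.reducedFun V)
          (hF.reducedDistribution D))
        {γ | γ ∈ invariantForms G g D ∧
          ∃ c : ℝ, ∀ q, energySharp g.at V (fun q => (γ q).toLinearMap) q = c}) := by
  have tf := fun α => hF.isCocycle_tfae hg hDs hD α
  have he := fun α => hF.constrainedEnergySharp_pullback hg hV hD α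
  have hHJ : ∀ α, α ∈ hamiltonJacobiCocycles hF.atiyahAlgebroid (hF.reducedMetric g)
      (hF.reducedFun V) (hF.reducedDistribution D) ↔
      hF.pullback hD α ∈ hamiltonJacobiCocycles (tangentAlgebroid E Q) g.at V D := by
    intro α
    refine and_congr ((tf α).out 0 2) ?_
    -- Surjectivity of `F` turns the equation at all base points into the equation at all `F q`.
    rw [he α, hF.surjective.forall]
    exact forall_congr' fun q => hF.dFun_constrain_comp_eq_zero_iff hD _ q
  have hconst : ∀ α, α ∈ constantEnergyCocycles hF.atiyahAlgebroid (hF.reducedMetric g)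
      (hF.reducedFun V) (hF.reducedDistribution D) ↔
      hF.pullback hD α ∈ constantEnergyCocycles (tangentAlgebroid E Q) g.at V D := by
    intro α
    refine and_congr ((tf α).out 0 2) (exists_congr fun c => ?_)
    rw [he α, hF.surjective.forall]
  refine ⟨⟨hF.bijOn_pullback hD hHJ, hF.bijOn_extendByProj_pullback hg hD fun α => ?_⟩,
    hF.bijOn_pullback hD hconst, hF.bijOn_extendByProj_pullback hg hD
      (p := fun γ => ∃ c : ℝ, ∀ q, energySharp g.at V (fun q => (γ q).toLinearMap) q = c)
      fun α => ?_⟩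
  · rw [hHJ]
    -- The 1-form statement is compared with the one already obtained on `D`; both energies are the
    -- same function on `Q`.
    refine and_congr ((tf α).out 2 1) ?_
    rw [energySharp_extendByProj]
    refine forall_congr' fun q => (dFun_constrain_eq_zero_iff g D _ q).trans ?_
    rw [Submodule.mem_dualAnnihilator]
  · rw [hconst]
    refine and_congr ((tf α).out 2 1) ?_
    rw [energySharp_extendByProj]
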